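/- Let $\Bbbk$ be a field and let $C$ be a (coassociative, counital) coalgebra over $\Bbbk$, with dual algebra $C^*$ under the convolution product $(f*g)(c)=f(c_{(1)})g(c_{(2)})$. Let $\mathfrak{M}^C$ be the category of right $C$-comodules and $\mathfrak{M}^C_{\mathrm{fd}}$ its full subcategory of finite-dimensional comodules. Every right $C$-comodule $M$ is a left $C^*$-module by $f\rightharpoonup m=m_{(0)}f(m_{(1)})$; a left $C^*$-module is rational if it arises in this way, and $N^{\mathrm{rat}}$ denotes the largest rational submodule of a left $C^*$-module $N$, regarded as a right $C$-comodule. Define functors $\mathbb{N}^{\mathrm L}_C,\mathbb{N}^{\mathrm R}_C:\mathfrak{M}^C\to\mathfrak{M}^C$ by $$\mathbb{N}^{\mathrm L}_C(M)=\mathrm{Hom}^C(C,M)^{\mathrm{rat}},\qquad \mathbb{N}^{\mathrm R}_C(M)=C\otimes_{C^*}M,$$ where $\mathrm{Hom}^C(C,M)$ is the space of right $C$-colinear maps with the action $(f\cdot\varphi)(c)=f(c_{(1)})\varphi(c_{(2)})$, $C$ is a right $C^*$-module by $c\leftharpoonup f=f(c_{(1)})c_{(2)}$, and $C\otimes_{C^*}M$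 has the coaction $c\otimes m\mapsto (c_{(1)}\otimes m)\otimes c_{(2)}$. The coalgebra $C$ is called semiperfect if every finite-dimensional right $C$-comodule has a projective cover in the category of right $C$-comodules and every finite-dimensional left $C$-comodule has a projective cover in the category of left $C$-comodules. Suppose that $C$ is semiperfect. There is an adjunction $\mathbb{N}^{\mathrm R}_C\dashv\mathbb{N}^{\mathrm L}_C$ with unit $m\mapsto(c\mapsto c\otimes m)$ and counit $c\otimes\xi\mapsto\xi(c)$, and the following hold. (a) $\mathbb{N}^{\mathrm L}_C$ and $\mathbb{N}^{\mathrm R}_C$ send finite-dimensional comodules to finite-dimensional comodules, and the adjunction $\mathbb{N}^{\mathrm R}_C\dashv\mathbb{N}^{\mathrm L}_C$ restricts to an adjunction between the restricted functors $\mathfrak{M}^C_{\mathrm{fd}}\rightleftarrows\mathfrak{M}^C_{\mathrm{fd}}$ (with the restricted unit and counit). (b) Let $\mathfrak{I}^C_{\mathrm{fd}}$ and $\mathfrak{P}^C_{\mathrm{fd}}$ be the full subcategories of injective and of projective objects of $\mathfrak{M}^C_{\mathrm{fd}}$. Then $\mathbb{N}^{\mathrm L}_C$ maps $\mathfrak{I}^C_{\mathrm{fd}}$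 to $\mathfrak{P}^C_{\mathrm{fd}}$, $\mathbb{N}^{\mathrm R}_C$ maps $\mathfrak{P}^C_{\mathrm{fd}}$ to $\mathfrak{I}^C_{\mathrm{fd}}$, and the resulting functors $\mathbb{N}^{\mathrm L}_C:\mathfrak{I}^C_{\mathrm{fd}}\to\mathfrak{P}^C_{\mathrm{fd}}$ and $\mathbb{N}^{\mathrm R}_C:\mathfrak{P}^C_{\mathrm{fd}}\to\mathfrak{I}^C_{\mathrm{fd}}$ are mutually quasi-inverse. -/

import Mathlib

open CategoryTheory TensorProduct

universe u v

noncomputable section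

namespace Nakayama

/-! ### Slices of tensors over a field -/

section Slice

variable {k : Type u} [Field k] {C : Type v} [AddCommGroup C] [Module k C]
variable {N : Type*} [AddCommGroup N] [Module k N] {N' : Type*} [AddCommGroup N'] [Module k N']

/-- `slice f` is the map `N ⊗ C → N`, `n ⊗ c ↦ f(c) n`. -/
def slice (N : Type*) [AddCommGroup N] [Module k N] (f : C →ₗ[k] k) : N ⊗[k] C →ₗ[k] N :=
  (TensorProduct.rid k N).toLinearMap ∘ₗ f.lTensor N

@[simp] theorem slice_tmul (f : C →ₗ[k] k) (n : N) (c : C) :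
    slice N f (n ⊗ₜ[k] c) = f c • n := by
  simp [slice]

theorem slice_rTensor (f : C →ₗ[k] k) (g : N →ₗ[k] N') (t : N ⊗[k] C) :
    slice N' f (g.rTensor C t) = g (slice N f t) := by
  induction t with
  | zero => simp
  | tmul n c => simp
  | add x y hx hy => simp [hx, hy]

theorem exists_expansion (t : N ⊗[k] C) :
    ∃ (ι : Type v) (b : ι → C) (g : ι → (C →ₗ[k] k)) (s : Finset ι),
      t = ∑ i ∈ s, slice N (g i) t ⊗ₜ[k] b i := by
  classical
  let B := Module.Basis.ofVectorSpace k C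
  obtain ⟨a, rfl⟩ := TensorProduct.eq_repr_basis_right B t
  refine ⟨_, B, B.coord, a.support, ?_⟩
  rw [Finsupp.sum]
  refine Finset.sum_congr rfl fun i hi => ?_
  congr 1
  simp only [map_sum, slice_tmul, Module.Basis.coord_apply, Module.Basis.repr_self]
  rw [Finset.sum_eq_single i]
  · simp
  · intro j _ hj
    simp [Finsupp.single_eq_of_ne, hj.symm]
  · intro h
    exact absurd hi h

theorem slice_ext {t t' : N ⊗[k] C} (h : ∀ f : C →ₗ[k] k, slice N f t = slice N f t') :
    t = t' := by
  rw [← sub_eq_zero]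
  obtain ⟨ι, b, g, s, hs⟩ := exists_expansion (t - t')
  rw [hs]
  refine Finset.sum_eq_zero fun i _ => ?_
  rw [map_sub, h, sub_self, zero_tmul]

end Slice

/-! ### The dual algebra and right comodules -/

/-- The dual algebra `C^*` of a coalgebra `C`, with the convolution product
`(f * g)(c) = f(c₁) g(c₂)`. -/
abbrev DualAlg (k : Type u) [Field k] (C : Type v) [AddCommGroup C] [Module k C] :=
  WithConv (C →ₗ[k] k)

theorem dual_ext {k : Type u} [Field k] {C : Type v} [AddCommGroup C] [Module k C] {c d : C}
    (h : ∀ f : DualAlg k C, f.ofConv c = f.ofConv d) : c = d := by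
  rw [← sub_eq_zero]
  refine (Module.forall_dual_apply_eq_zero_iff k (c - d)).1 fun f => ?_
  rw [map_sub, sub_eq_zero]
  exact h (WithConv.toConv f)

section DoubleSlice

variable {k : Type u} [Field k] {C : Type v} [AddCommGroup C] [Module k C] [Coalgebra k C]
variable {N : Type*} [AddCommGroup N] [Module k N]

theorem slice_slice_comul (f g : DualAlg k C) (t : N ⊗[k] C) :
    slice N f.ofConv (slice (N ⊗[k] C) g.ofConv
      ((TensorProduct.assoc k N C C).symm ((Coalgebra.comul (R := k)).lTensor N t))) =
      slice N (f * g).ofConv t := by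
  induction t with
  | zero => simp
  | add x y hx hy => simp only [map_add, hx, hy]
  | tmul n c =>
    have key : ∀ w : C ⊗[k] C, slice N f.ofConv (slice (N ⊗[k] C) g.ofConv
        ((TensorProduct.assoc k N C C).symm (n ⊗ₜ[k] w))) =
        LinearMap.mul' k k (TensorProduct.map f.ofConv g.ofConv w) • n := by
      intro w
      induction w with
      | zero => simp
      | add x y hx hy => simp only [tmul_add, map_add, hx, hy, add_smul]
      | tmul x y => simp [smul_smul, mul_comm]
    rw [LinearMap.lTensor_tmul, key, slice_tmul]
    rfl

end DoubleSlice

/-- A right comodule structure over the coalgebra `C` on the vector space `M`. -/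
class RightComodule (k : Type u) [Field k] (C : Type v) [AddCommGroup C] [Module k C]
    [Coalgebra k C] (M : Type*) [AddCommGroup M] [Module k M] where
  /-- the coaction `m ↦ m₀ ⊗ m₁` -/
  coact : M →ₗ[k] M ⊗[k] C
  coassoc : (TensorProduct.assoc k M C C).toLinearMap ∘ₗ coact.rTensor C ∘ₗ coact =
    (Coalgebra.comul (R := k) (A := C)).lTensor M ∘ₗ coact
  counit_coact : (Coalgebra.counit (R := k) (A := C)).lTensor M ∘ₗ coact =
    (TensorProduct.mk k M k).flip 1

section Action

variable {k : Type u} [Field k] {C : Type v} [AddCommGroup C] [Module k C] [Coalgebra k C]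

/-- A coaction is determined by, and may be checked on, the maps `m ↦ m₀ f(m₁)`. -/
@[reducible] def RightComodule.ofSlice {M : Type*} [AddCommGroup M] [Module k M] (ρ : M →ₗ[k] M ⊗[k] C)
    (hmul : ∀ (f g : DualAlg k C) (m : M),
      slice M f.ofConv (ρ (slice M g.ofConv (ρ m))) = slice M (f * g).ofConv (ρ m))
    (hone : ∀ m : M, slice M (1 : DualAlg k C).ofConv (ρ m) = m) : RightComodule k C M where
  coact := ρ
  coassoc := by
    ext m
    apply (TensorProduct.assoc k M C C).symm.injective
    refine slice_ext fun g => slice_ext fun f => ?_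
    have h := slice_slice_comul (WithConv.toConv f) (WithConv.toConv g) (ρ m)
    simp only [LinearMap.comp_apply, LinearEquiv.coe_coe, LinearEquiv.symm_apply_apply,
      slice_rTensor]
    exact (hmul (WithConv.toConv f) (WithConv.toConv g) m).trans h.symm
  counit_coact := by
    ext m
    apply (TensorProduct.rid k M).injective
    exact (hone m).trans (by simp)

variable {M : Type*} [AddCommGroup M] [Module k M] [RightComodule k C M]

/-- The left action of `C^*` on a right `C`-comodule: `f ⇀ m = m₀ f(m₁)`. -/
def leftAct (f : DualAlg k C) : M →ₗ[k] M :=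
  slice M f.ofConv ∘ₗ RightComodule.coact

theorem leftAct_mul (f g : DualAlg k C) (m : M) :
    leftAct (f * g) m = leftAct f (leftAct g m) := by
  have h := LinearMap.congr_fun (RightComodule.coassoc (k := k) (C := C) (M := M)) m
  simp only [LinearMap.comp_apply, LinearEquiv.coe_coe] at h
  simp only [leftAct, LinearMap.comp_apply]
  rw [← slice_slice_comul, ← h, LinearEquiv.symm_apply_apply, slice_rTensor]

theorem leftAct_one (m : M) : leftAct (1 : DualAlg k C) m = m := by
  have h := LinearMap.congr_fun (RightComodule.counit_coact (k := k) (C := C) (M := M)) m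
  simp only [LinearMap.comp_apply, LinearMap.flip_apply, TensorProduct.mk_apply] at h
  exact (congrArg (TensorProduct.rid k M) h).trans (by simp)

/-- The coalgebra `C` as a right comodule over itself. -/
instance selfComodule : RightComodule k C C where
  coact := Coalgebra.comul
  coassoc := Coalgebra.coassoc
  counit_coact := Coalgebra.lTensor_counit_comp_comul

/-- The right action of `C^*` on `C` coming from the left comodule structure:
`c ↼ f = f(c₁) c₂`. -/
def rightAct (f : DualAlg k C) : C →ₗ[k] C :=
  (TensorProduct.lid k C).toLinearMap ∘ₗ f.ofConv.rTensor C ∘ₗ Coalgebra.comul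

theorem apply_leftAct (h g : DualAlg k C) (c : C) :
    h.ofConv (leftAct g c) = (h * g).ofConv c := by
  have key : ∀ w : C ⊗[k] C, h.ofConv (slice C g.ofConv w) =
      LinearMap.mul' k k (TensorProduct.map h.ofConv g.ofConv w) := by
    intro w
    induction w with
    | zero => simp
    | add x y hx hy => simp only [map_add, hx, hy]
    | tmul x y => simp [mul_comm]
  exact key _

theorem apply_rightAct (h g : DualAlg k C) (c : C) :
    h.ofConv (rightAct g c) = (g * h).ofConv c := by
  have key : ∀ w : C ⊗[k] C, h.ofConv (TensorProduct.lid k C (g.ofConv.rTensor C w)) =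
      LinearMap.mul' k k (TensorProduct.map g.ofConv h.ofConv w) := by
    intro w
    induction w with
    | zero => simp
    | add x y hx hy => simp only [map_add, hx, hy]
    | tmul x y => simp
  exact key _

theorem leftAct_rightAct (f g : DualAlg k C) (c : C) :
    leftAct g (rightAct f c) = rightAct f (leftAct g c) := by
  refine dual_ext (k := k) fun h => ?_
  rw [apply_leftAct, apply_rightAct, apply_rightAct, apply_leftAct, mul_assoc]

theorem rightAct_mul (f g : DualAlg k C) (c : C) :
    rightAct (f * g) c = rightAct g (rightAct f c) := by
  refine dual_ext (k := k) fun h => ?_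
  simp only [apply_rightAct, mul_assoc]

theorem rightAct_one (c : C) : rightAct (1 : DualAlg k C) c = c := by
  refine dual_ext (k := k) fun h => ?_
  rw [apply_rightAct, one_mul]

theorem rightAct_add (f g : DualAlg k C) (c : C) :
    rightAct (f + g) c = rightAct f c + rightAct g c := by
  refine dual_ext (k := k) fun h => ?_
  simp only [map_add, apply_rightAct, add_mul, WithConv.ofConv_add, LinearMap.add_apply]

theorem rightAct_zero (c : C) : rightAct (0 : DualAlg k C) c = 0 := by
  refine dual_ext (k := k) fun h => ?_
  simp [apply_rightAct]

theorem rightAct_smul (r : k) (f : DualAlg k C) (c : C) :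
    rightAct (r • f) c = r • rightAct f c := by
  refine dual_ext (k := k) fun h => ?_
  simp only [map_smul, apply_rightAct, smul_mul_assoc, WithConv.ofConv_smul,
    LinearMap.smul_apply]

end Action

/-! ### The category of right comodules -/

/-- The space `Hom^C(M, N)` of `C`-colinear maps. -/
def comodHom (k : Type u) [Field k] (C : Type v) [AddCommGroup C] [Module k C] [Coalgebra k C]
    (M N : Type*) [AddCommGroup M] [Module k M] [RightComodule k C M]
    [AddCommGroup N] [Module k N] [RightComodule k C N] : Submodule k (M →ₗ[k] N) where
  carrier := {φ | φ.rTensor C ∘ₗ RightComodule.coact = RightComodule.coact ∘ₗ φ}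
  add_mem' {φ ψ} hφ hψ := by
    simp only [Set.mem_ofPred_eq] at hφ hψ ⊢
    rw [LinearMap.rTensor_add, LinearMap.add_comp, LinearMap.comp_add, hφ, hψ]
  zero_mem' := by simp
  smul_mem' r φ hφ := by
    simp only [Set.mem_ofPred_eq] at hφ ⊢
    rw [LinearMap.rTensor_smul, LinearMap.smul_comp, LinearMap.comp_smul, hφ]

theorem mem_comodHom_iff {k : Type u} [Field k] {C : Type v} [AddCommGroup C] [Module k C]
    [Coalgebra k C] {M N : Type*} [AddCommGroup M] [Module k M] [RightComodule k C M]
    [AddCommGroup N] [Module k N] [RightComodule k C N] (φ : M →ₗ[k] N) :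
    φ ∈ comodHom k C M N ↔
      ∀ (f : DualAlg k C) (m : M), φ (leftAct f m) = leftAct f (φ m) := by
  constructor
  · intro h f m
    have h' := LinearMap.congr_fun (show φ.rTensor C ∘ₗ RightComodule.coact =
      RightComodule.coact ∘ₗ φ from h) m
    simp only [LinearMap.comp_apply] at h'
    simp only [leftAct, LinearMap.comp_apply]
    rw [← h', slice_rTensor]
  · intro h
    change φ.rTensor C ∘ₗ RightComodule.coact = RightComodule.coact ∘ₗ φ
    ext m
    refine slice_ext fun f => ?_
    simp only [LinearMap.comp_apply, slice_rTensor]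
    exact h (WithConv.toConv f) m

/-- The objects of the category `𝔐^C` of all right `C`-comodules. -/
structure Comod (k : Type u) [Field k] (C : Type v) [AddCommGroup C] [Module k C]
    [Coalgebra k C] where
  carrier : Type v
  [addCommGroup : AddCommGroup carrier]
  [module : Module k carrier]
  [comodule : RightComodule k C carrier]

attribute [instance] Comod.addCommGroup Comod.module Comod.comodule

section Category

variable (k : Type u) [Field k] (C : Type v) [AddCommGroup C] [Module k C] [Coalgebra k C]

instance : CoeSort (Comod k C) (Type v) := ⟨Comod.carrier⟩

instance : Category (Comod k C) where
  Hom M N := comodHom k C M N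
  id M := ⟨LinearMap.id, (mem_comodHom_iff _).2 fun _ _ => rfl⟩
  comp φ ψ := ⟨ψ.1 ∘ₗ φ.1, (mem_comodHom_iff _).2 fun f m => by
    simp only [LinearMap.comp_apply]
    rw [(mem_comodHom_iff φ.1).1 φ.2, (mem_comodHom_iff ψ.1).1 ψ.2]⟩

/-- The property of being finite-dimensional. -/
def isFd : ObjectProperty (Comod k C) := fun M => FiniteDimensional k M

/-- The category `𝔐_fd^C` of finite-dimensional right `C`-comodules. -/
abbrev FdComod := (isFd k C).FullSubcategory

/-- The full subcategory `𝔦_fd^C` of injective objects of `𝔐_fd^C`. -/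
abbrev InjFd := (isInjective (FdComod k C)).FullSubcategory

/-- The full subcategory `𝔓_fd^C` of projective objects of `𝔐_fd^C`. -/
abbrev ProjFd := (isProjective (FdComod k C)).FullSubcategory

end Category

/-! ### Semiperfect coalgebras -/

/-- `p : P ⟶ M` is a projective cover: `P` is projective and `p` is an essential (superfluous)
epimorphism. -/
structure IsProjectiveCover {A : Type*} [Category A] {P M : A} (p : P ⟶ M) : Prop where
  projective : Projective P
  epi : Epi p
  essential : ∀ (X : A) (g : X ⟶ P), Epi (g ≫ p) → Epi g

/-- Every finite-dimensional right `C`-comodule has a projective cover in the category of all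
right `C`-comodules. -/
def IsRightSemiperfect (k : Type u) [Field k] (C : Type v) [AddCommGroup C] [Module k C]
    [Coalgebra k C] : Prop :=
  ∀ M : Comod k C, FiniteDimensional k M → ∃ (P : Comod k C) (p : P ⟶ M), IsProjectiveCover p

/-- The underlying space of the co-opposite coalgebra `C^cop`. -/
def Cop (C : Type v) : Type v := C

section Cop

variable (k : Type u) [Field k] (C : Type v) [AddCommGroup C] [Module k C] [Coalgebra k C]

instance : AddCommGroup (Cop C) := inferInstanceAs (AddCommGroup C)

instance : Module k (Cop C) := inferInstanceAs (Module k C)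

/-- The comultiplication `c ↦ c₂ ⊗ c₁` of `C^cop`. -/
def copComul : C →ₗ[k] C ⊗[k] C :=
  (TensorProduct.comm k C C).toLinearMap ∘ₗ Coalgebra.comul

theorem copComul_coassoc : (TensorProduct.assoc k C C C).toLinearMap ∘ₗ
    (copComul k C).rTensor C ∘ₗ copComul k C = (copComul k C).lTensor C ∘ₗ copComul k C := by
  have h1 : (TensorProduct.assoc k C C C).toLinearMap ∘ₗ
      (TensorProduct.comm k C C).toLinearMap.rTensor C ∘ₗ
      (TensorProduct.comm k C (C ⊗[k] C)).toLinearMap ∘ₗ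
      (TensorProduct.assoc k C C C).toLinearMap =
      (TensorProduct.comm k C C).toLinearMap.lTensor C ∘ₗ
      (TensorProduct.comm k (C ⊗[k] C) C).toLinearMap := by
    ext x y z
    simp
  have h2 : (Coalgebra.comul (R := k) (A := C)).rTensor C ∘ₗ
      (TensorProduct.comm k C C).toLinearMap =
      (TensorProduct.comm k C (C ⊗[k] C)).toLinearMap ∘ₗ
      (Coalgebra.comul (R := k) (A := C)).lTensor C := by
    ext x y
    simp
  have h3 : (Coalgebra.comul (R := k) (A := C)).lTensor C ∘ₗ
      (TensorProduct.comm k C C).toLinearMap =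
      (TensorProduct.comm k (C ⊗[k] C) C).toLinearMap ∘ₗ
      (Coalgebra.comul (R := k) (A := C)).rTensor C := by
    ext x y
    simp
  ext c
  have e1 := LinearMap.congr_fun h1
    ((Coalgebra.comul (R := k) (A := C)).rTensor C (Coalgebra.comul c))
  have e2 := LinearMap.congr_fun h2 (Coalgebra.comul c)
  have e3 := LinearMap.congr_fun h3 (Coalgebra.comul c)
  simp only [LinearMap.comp_apply, LinearEquiv.coe_coe] at e1 e2 e3
  simp only [copComul, LinearMap.rTensor_comp, LinearMap.lTensor_comp, LinearMap.comp_apply,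
    LinearEquiv.coe_coe]
  rw [e2, e3, ← e1, Coalgebra.coassoc_apply]

/-- The co-opposite coalgebra `C^cop`. -/
instance : Coalgebra k (Cop C) where
  comul := copComul k C
  counit := Coalgebra.counit (R := k) (A := C)
  coassoc := copComul_coassoc k C
  rTensor_counit_comp_comul := by
    have h : (Coalgebra.counit (R := k) (A := C)).rTensor C ∘ₗ
        (TensorProduct.comm k C C).toLinearMap =
        (TensorProduct.comm k C k).toLinearMap ∘ₗ
        (Coalgebra.counit (R := k) (A := C)).lTensor C := by
      ext x y
      simp
    change (Coalgebra.counit (R := k) (A := C)).rTensor C ∘ₗ copComul k C =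
      TensorProduct.mk k k C 1
    rw [copComul, ← LinearMap.comp_assoc, h, LinearMap.comp_assoc,
      Coalgebra.lTensor_counit_comp_comul]
    ext c
    simp
  lTensor_counit_comp_comul := by
    have h : (Coalgebra.counit (R := k) (A := C)).lTensor C ∘ₗ
        (TensorProduct.comm k C C).toLinearMap =
        (TensorProduct.comm k k C).toLinearMap ∘ₗ
        (Coalgebra.counit (R := k) (A := C)).rTensor C := by
      ext x y
      simp
    change (Coalgebra.counit (R := k) (A := C)).lTensor C ∘ₗ copComul k C =
      (TensorProduct.mk k C k).flip 1
    rw [copComul, ← LinearMap.comp_assoc, h, LinearMap.comp_assoc,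
      Coalgebra.rTensor_counit_comp_comul]
    ext c
    simp

/-- Every finite-dimensional left `C`-comodule has a projective cover in the category of all
left `C`-comodules; left `C`-comodules are the right `C^cop`-comodules, through the flip
`C ⊗ M ≅ M ⊗ C`. -/
def IsLeftSemiperfect : Prop := IsRightSemiperfect k (Cop C)

/-- Semiperfect coalgebras: both left and right semiperfect. -/
def IsSemiperfect : Prop := IsLeftSemiperfect k C ∧ IsRightSemiperfect k C

end Cop

/-! ### The rational part of a left `C^*`-module -/

section Rational

variable (k : Type u) [Field k] (C : Type v) [AddCommGroup C] [Module k C] [Coalgebra k C]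
variable (N : Type*) [AddCommGroup N] [Module k N] [Module (DualAlg k C) N]
  [IsScalarTower k (DualAlg k C) N]

/-- The rational part `N^rat` of a left `C^*`-module `N`: the elements `n` for which there is
a tensor `∑ nᵢ ⊗ cᵢ ∈ N ⊗ C` with `f • n = ∑ f(cᵢ) nᵢ` for all `f ∈ C^*`. It is a `C^*`-submodule,
it carries a `C`-comodule structure inducing the `C^*`-action, and it contains the image of every
`C^*`-linear map from a `C`-comodule, so it is the largest rational submodule;
see `smul_mem_rat`, `leftAct_rat`, `map_mem_rat`. -/
def rat : Submodule k N where
  carrier := {n | ∃ t : N ⊗[k] C, ∀ f : DualAlg k C, slice N f.ofConv t = f • n}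
  add_mem' := by
    rintro a b ⟨s, hs⟩ ⟨t, ht⟩
    exact ⟨s + t, fun f => by rw [map_add, hs, ht, smul_add]⟩
  zero_mem' := ⟨0, fun f => by simp⟩
  smul_mem' := by
    rintro r a ⟨s, hs⟩
    exact ⟨r • s, fun f => by rw [map_smul, hs, smul_comm]⟩

variable {N}

theorem smul_mem_rat (g : DualAlg k C) {n : N} (hn : n ∈ rat k C N) : g • n ∈ rat k C N := by
  obtain ⟨t, ht⟩ := hn
  refine ⟨slice (N ⊗[k] C) g.ofConv
    ((TensorProduct.assoc k N C C).symm ((Coalgebra.comul (R := k)).lTensor N t)), fun f => ?_⟩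
  rw [slice_slice_comul, ht, mul_smul]

theorem exists_rat_tensor (n : rat k C N) :
    ∃ t : rat k C N ⊗[k] C, ∀ f : DualAlg k C, (slice (rat k C N) f.ofConv t : N) = f • n.1 := by
  obtain ⟨t, ht⟩ := n.2
  obtain ⟨ι, b, g, s, hs⟩ := exists_expansion t
  refine ⟨∑ i ∈ s, (⟨WithConv.toConv (g i) • n.1, smul_mem_rat k C _ n.2⟩ : rat k C N) ⊗ₜ[k] b i,
    fun f => ?_⟩
  rw [← ht f, hs]
  simp only [map_sum, slice_tmul, AddSubmonoidClass.coe_finsetSum, SetLike.val_smul]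
  refine Finset.sum_congr rfl fun i _ => ?_
  rw [← ht]

theorem slice_rat_ext {t t' : rat k C N ⊗[k] C}
    (h : ∀ f : DualAlg k C, (slice (rat k C N) f.ofConv t : N) = slice (rat k C N) f.ofConv t') :
    t = t' :=
  slice_ext fun f => Subtype.ext (h (WithConv.toConv f))

/-- The coaction on the rational part: `n ↦ n₀ ⊗ n₁` with `f • n = n₀ f(n₁)` for all `f`. -/
def ratCoact : rat k C N →ₗ[k] rat k C N ⊗[k] C where
  toFun n := (exists_rat_tensor k C n).choose
  map_add' m n := slice_rat_ext k C fun f => by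
    have h := fun n : rat k C N => (exists_rat_tensor k C n).choose_spec f
    refine (h (m + n)).trans (((smul_add f m.1 n.1).trans ?_).trans
      (congrArg Subtype.val (map_add (slice (rat k C N) f.ofConv) _ _)).symm)
    exact congrArg₂ (· + ·) (h m).symm (h n).symm
  map_smul' r n := slice_rat_ext k C fun f => by
    have h := fun n : rat k C N => (exists_rat_tensor k C n).choose_spec f
    refine (h (r • n)).trans (((smul_comm f r n.1).trans ?_).trans
      (congrArg Subtype.val (map_smul (slice (rat k C N) f.ofConv) r _)).symm)
    exact congrArg (r • ·) (h n).symm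

theorem slice_ratCoact (f : DualAlg k C) (n : rat k C N) :
    (slice (rat k C N) f.ofConv (ratCoact k C n) : N) = f • n.1 :=
  (exists_rat_tensor k C n).choose_spec f

/-- The right `C`-comodule structure of the rational part. -/
instance ratComodule : RightComodule k C (rat k C N) :=
  RightComodule.ofSlice (ratCoact k C)
    (fun f g n => Subtype.ext (by rw [slice_ratCoact, slice_ratCoact, slice_ratCoact, mul_smul]))
    (fun n => Subtype.ext (by rw [slice_ratCoact, one_smul]))

theorem leftAct_rat (f : DualAlg k C) (n : rat k C N) :
    ((leftAct f n : rat k C N) : N) = f • n.1 :=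
  slice_ratCoact k C f n

theorem map_mem_rat {M : Type*} [AddCommGroup M] [Module k M] [RightComodule k C M]
    (g : M →ₗ[k] N) (hg : ∀ (f : DualAlg k C) (m : M), g (leftAct f m) = f • g m) (m : M) :
    g m ∈ rat k C N :=
  ⟨g.rTensor C (RightComodule.coact m), fun f => by rw [slice_rTensor, ← hg]; rfl⟩

variable {N' : Type*} [AddCommGroup N'] [Module k N'] [Module (DualAlg k C) N']
  [IsScalarTower k (DualAlg k C) N']

/-- The colinear map `N^rat → N'^rat` obtained from a `C^*`-linear map `N → N'`. -/
def ratMap (g : N →ₗ[k] N') (hg : ∀ (f : DualAlg k C) (n : N), g (f • n) = f • g n) :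
    comodHom k C (rat k C N) (rat k C N') :=
  ⟨(g ∘ₗ (rat k C N).subtype).codRestrict (rat k C N') fun n =>
      map_mem_rat k C (g ∘ₗ (rat k C N).subtype) (fun f n => by
        rw [LinearMap.comp_apply, Submodule.subtype_apply, leftAct_rat, hg]; rfl) n,
    (mem_comodHom_iff _).2 fun f n => Subtype.ext (by
      rw [leftAct_rat]
      change g ((leftAct f n : rat k C N) : N) = f • g n.1
      rw [leftAct_rat, hg])⟩

end Rational

/-! ### The left exact Nakayama functor `M ↦ Hom^C(C, M)^rat` -/

section NakL

variable (k : Type u) [Field k] (C : Type v) [AddCommGroup C] [Module k C] [Coalgebra k C]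

section

variable (M : Type*) [AddCommGroup M] [Module k M] [RightComodule k C M]

/-- The left `C^*`-action on `Hom^C(C, M)`: `(f • φ)(c) = φ(c ↼ f) = f(c₁) φ(c₂)`. -/
instance homSMul : SMul (DualAlg k C) (comodHom k C C M) where
  smul f φ := ⟨φ.1 ∘ₗ rightAct f, (mem_comodHom_iff _).2 fun g c => by
    simp only [LinearMap.comp_apply]
    rw [← leftAct_rightAct, (mem_comodHom_iff φ.1).1 φ.2]⟩

variable {M}

theorem homSMul_apply (f : DualAlg k C) (φ : comodHom k C C M) (c : C) :
    (f • φ).1 c = φ.1 (rightAct f c) := rfl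

variable (M)

instance homModule : Module (DualAlg k C) (comodHom k C C M) where
  one_smul φ := Subtype.ext (LinearMap.ext fun c => by rw [homSMul_apply, rightAct_one])
  mul_smul f g φ := Subtype.ext (LinearMap.ext fun c => by
    rw [homSMul_apply, homSMul_apply, homSMul_apply, rightAct_mul])
  smul_zero f := Subtype.ext (LinearMap.ext fun c => rfl)
  smul_add f φ ψ := Subtype.ext (LinearMap.ext fun c => rfl)
  add_smul f g φ := Subtype.ext (LinearMap.ext fun c => by
    rw [homSMul_apply, rightAct_add, map_add]; rfl)
  zero_smul φ := Subtype.ext (LinearMap.ext fun c => by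
    rw [homSMul_apply, rightAct_zero, map_zero]; rfl)

instance : IsScalarTower k (DualAlg k C) (comodHom k C C M) where
  smul_assoc r f φ := Subtype.ext (LinearMap.ext fun c => by
    rw [homSMul_apply, rightAct_smul, map_smul]; rfl)

end

/-- Postcomposition `Hom^C(C, M) → Hom^C(C, M')` with a colinear map `M → M'`. -/
def homPost {M M' : Comod k C} (g : M ⟶ M') : comodHom k C C M →ₗ[k] comodHom k C C M' where
  toFun φ := ⟨g.1 ∘ₗ φ.1, (mem_comodHom_iff _).2 fun f m => by
    simp only [LinearMap.comp_apply]
    rw [(mem_comodHom_iff φ.1).1 φ.2, (mem_comodHom_iff g.1).1 g.2]⟩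
  map_add' φ ψ := Subtype.ext (LinearMap.ext fun c => map_add g.1 _ _)
  map_smul' r φ := Subtype.ext (LinearMap.ext fun c => map_smul g.1 _ _)

/-- The left exact Nakayama functor `M ↦ Hom^C(C, M)^rat`. -/
def nakL : Comod k C ⥤ Comod k C where
  obj M := ⟨rat k C (comodHom k C C M)⟩
  map g := ratMap k C (homPost k C g) fun _ _ => rfl
  map_id _ := rfl
  map_comp _ _ := rfl

end NakL

/-! ### The right exact Nakayama functor `M ↦ C ⊗_{C^*} M` -/

section NakR

variable (k : Type u) [Field k] (C : Type v) [AddCommGroup C] [Module k C] [Coalgebra k C]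

section

variable (M : Type*) [AddCommGroup M] [Module k M] [RightComodule k C M]

/-- The subspace of `C ⊗ M` spanned by `(c ↼ f) ⊗ m - c ⊗ (f ⇀ m)`. -/
def balanced : Submodule k (C ⊗[k] M) :=
  Submodule.span k {x | ∃ (f : DualAlg k C) (c : C) (m : M),
    x = rightAct f c ⊗ₜ[k] m - c ⊗ₜ[k] leftAct f m}

/-- The tensor product `C ⊗_{C^*} M` over the (non-commutative) algebra `C^*`. -/
def DualTensor := (C ⊗[k] M) ⧸ balanced k C M

instance : AddCommGroup (DualTensor k C M) :=
  inferInstanceAs (AddCommGroup ((C ⊗[k] M) ⧸ balanced k C M))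

instance : Module k (DualTensor k C M) :=
  inferInstanceAs (Module k ((C ⊗[k] M) ⧸ balanced k C M))

/-- The projection `C ⊗ M → C ⊗_{C^*} M`. -/
def dualProj : C ⊗[k] M →ₗ[k] DualTensor k C M := (balanced k C M).mkQ

variable {M}

/-- The element `c ⊗_{C^*} m`. -/
def dualTmul (c : C) (m : M) : DualTensor k C M := dualProj k C M (c ⊗ₜ[k] m)

theorem dualTmul_balanced (f : DualAlg k C) (c : C) (m : M) :
    dualTmul k C (rightAct f c) m = dualTmul k C c (leftAct f m) := by
  rw [dualTmul, dualTmul, ← sub_eq_zero, ← map_sub]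
  refine (Submodule.Quotient.mk_eq_zero _).2 ?_
  exact Submodule.subset_span ⟨f, c, m, rfl⟩

variable (M)

/-- The map `C ⊗ M → (C ⊗_{C^*} M) ⊗ C`, `c ⊗ m ↦ (c₁ ⊗_{C^*} m) ⊗ c₂`. -/
def preCoact : C ⊗[k] M →ₗ[k] DualTensor k C M ⊗[k] C :=
  (dualProj k C M).rTensor C ∘ₗ (TensorProduct.rightComm k C C M).toLinearMap ∘ₗ
    (Coalgebra.comul (R := k) (A := C)).rTensor M

variable {M}

theorem slice_preCoact (f : DualAlg k C) (c : C) (m : M) :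
    slice _ f.ofConv (preCoact k C M (c ⊗ₜ[k] m)) = dualTmul k C (leftAct f c) m := by
  have key : ∀ w : C ⊗[k] C, slice _ f.ofConv ((dualProj k C M).rTensor C
      (TensorProduct.rightComm k C C M (w ⊗ₜ[k] m))) = dualTmul k C (slice C f.ofConv w) m := by
    intro w
    induction w with
    | zero => simp [dualTmul]
    | add x y hx hy =>
      simp only [add_tmul, map_add, hx, hy]
      simp only [dualTmul, add_tmul, map_add]
    | tmul x y =>
      rw [TensorProduct.rightComm_tmul, LinearMap.rTensor_tmul, slice_tmul, slice_tmul, dualTmul,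
        ← smul_tmul', map_smul]
  exact key (Coalgebra.comul c)

variable (M)

/-- The coaction `c ⊗_{C^*} m ↦ (c₁ ⊗_{C^*} m) ⊗ c₂` on `C ⊗_{C^*} M`. -/
def tensorCoact : DualTensor k C M →ₗ[k] DualTensor k C M ⊗[k] C :=
  (balanced k C M).liftQ (preCoact k C M) (by
    refine Submodule.span_le.2 ?_
    rintro _ ⟨f, c, m, rfl⟩
    rw [SetLike.mem_coe, LinearMap.mem_ker, map_sub, sub_eq_zero]
    refine slice_ext fun g => ?_
    rw [show g = (WithConv.toConv g : DualAlg k C).ofConv from rfl, slice_preCoact,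
      slice_preCoact, leftAct_rightAct, dualTmul_balanced])

variable {M}

theorem slice_tensorCoact (f : DualAlg k C) (c : C) (m : M) :
    slice _ f.ofConv (tensorCoact k C M (dualTmul k C c m)) = dualTmul k C (leftAct f c) m :=
  slice_preCoact k C f c m

theorem dualTensor_ext {N : Type*} [AddCommGroup N] [Module k N]
    {g h : DualTensor k C M →ₗ[k] N}
    (H : ∀ (c : C) (m : M), g (dualTmul k C c m) = h (dualTmul k C c m)) : g = h :=
  Submodule.linearMap_qext _ (TensorProduct.ext' H)

variable (M)

instance tensorComodule : RightComodule k C (DualTensor k C M) :=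
  RightComodule.ofSlice (tensorCoact k C M)
    (fun f g x => LinearMap.congr_fun (f := slice _ f.ofConv ∘ₗ tensorCoact k C M ∘ₗ
        slice _ g.ofConv ∘ₗ tensorCoact k C M)
      (g := slice _ (f * g).ofConv ∘ₗ tensorCoact k C M) (dualTensor_ext k C fun c m => by
        simp only [LinearMap.comp_apply, slice_tensorCoact, leftAct_mul]) x)
    (fun x => LinearMap.congr_fun (f := slice _ (1 : DualAlg k C).ofConv ∘ₗ tensorCoact k C M)
      (g := LinearMap.id) (dualTensor_ext k C fun c m => by
        simp only [LinearMap.comp_apply, slice_tensorCoact, leftAct_one, LinearMap.id_apply]) x)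

variable {M}

theorem leftAct_dualTmul (f : DualAlg k C) (c : C) (m : M) :
    leftAct f (dualTmul k C c m) = dualTmul k C (leftAct f c) m :=
  slice_tensorCoact k C f c m

end

/-- The linear map `c ⊗_{C^*} m ↦ c ⊗_{C^*} g(m)` for a colinear map `g`. -/
def dualTensorMap {M M' : Comod k C} (g : M ⟶ M') : DualTensor k C M →ₗ[k] DualTensor k C M' :=
  (balanced k C M).mapQ (balanced k C M') (g.1.lTensor C) (by
    refine Submodule.span_le.2 ?_
    rintro _ ⟨f, c, m, rfl⟩
    refine Submodule.subset_span ⟨f, c, g.1 m, ?_⟩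
    rw [map_sub, LinearMap.lTensor_tmul, LinearMap.lTensor_tmul, (mem_comodHom_iff g.1).1 g.2])

theorem dualTensorMap_tmul {M M' : Comod k C} (g : M ⟶ M') (c : C) (m : M) :
    dualTensorMap k C g (dualTmul k C c m) = dualTmul k C c (g.1 m) := rfl

/-- The right exact Nakayama functor `M ↦ C ⊗_{C^*} M`. -/
def nakR : Comod k C ⥤ Comod k C where
  obj M := ⟨DualTensor k C M⟩
  map g := ⟨dualTensorMap k C g, (mem_comodHom_iff _).2 fun f x =>
    LinearMap.congr_fun (f := dualTensorMap k C g ∘ₗ leftAct f)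
      (g := leftAct f ∘ₗ dualTensorMap k C g) (dualTensor_ext k C fun c m => by
        simp only [LinearMap.comp_apply, leftAct_dualTmul, dualTensorMap_tmul]) x⟩
  map_id M := Subtype.ext (dualTensor_ext k C fun _ _ => rfl)
  map_comp g h := Subtype.ext (dualTensor_ext k C fun _ _ => rfl)

end NakR

/-! ### Restrictions -/

section Restrict

variable (k : Type u) [Field k] (C : Type v) [AddCommGroup C] [Module k C] [Coalgebra k C]

/-- The restriction of `nakL` to `𝔐_fd^C`, when it preserves finite-dimensionality. -/
abbrev nakLFd (hL : ∀ M : FdComod k C, isFd k C ((nakL k C).obj M.obj)) :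
    FdComod k C ⥤ FdComod k C :=
  (isFd k C).lift ((isFd k C).ι ⋙ nakL k C) hL

/-- The restriction of `nakR` to `𝔐_fd^C`, when it preserves finite-dimensionality. -/
abbrev nakRFd (hR : ∀ M : FdComod k C, isFd k C ((nakR k C).obj M.obj)) :
    FdComod k C ⥤ FdComod k C :=
  (isFd k C).lift ((isFd k C).ι ⋙ nakR k C) hR

/-- The restriction of an endofunctor of `𝔐_fd^C` to a functor from the injective to the
projective objects. -/
abbrev restrictInjProj (F : FdComod k C ⥤ FdComod k C)
    (hF : ∀ E : InjFd k C, Projective (F.obj E.obj)) : InjFd k C ⥤ ProjFd k C :=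
  (isProjective (FdComod k C)).lift ((isInjective (FdComod k C)).ι ⋙ F) hF

/-- The restriction of an endofunctor of `𝔐_fd^C` to a functor from the projective to the
injective objects. -/
abbrev restrictProjInj (F : FdComod k C ⥤ FdComod k C)
    (hF : ∀ P : ProjFd k C, Injective (F.obj P.obj)) : ProjFd k C ⥤ InjFd k C :=
  (isInjective (FdComod k C)).lift ((isProjective (FdComod k C)).ι ⋙ F) hF

end Restrict

end Nakayama

end

open Nakayama

/-!
Write `A = C^*`. A right `C`-comodule is the same as a rational left `A`-module, that is, a module
each of whose elements is annihilated by the functionals vanishing on a finite-dimensional subspace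
of `C`, and colinear maps are `A`-linear maps. The proof compares two classes of modules: the direct
summands of `A^n` (`HasDualBasis`) and the direct summands of `C^n` (`HasCodualBasis`). Since `C` is
an `A`-bimodule whose left linear endomorphisms are exactly the right multiplications by elements of
`A`, the functors `C ⊗_A -` and `Hom_A(C, -)` exchange `A` and `C`, hence these classes, and the
unit and counit are isomorphisms on them; with explicit dual and codual bases this is a direct
computation (`HasDualBasis.isIso_unit`, `HasCodualBasis.isIso_counit`). Modules of the first class
are projective, and those of the second class are injective among rational modules because `C` is
cofree.

Semiperfectness enters through two facts. A projective cover of a finite-dimensional comodule is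
finite-dimensional, because a finite-dimensional subcomodule already maps onto the comodule. The
linear dual of a finite-dimensional projective comodule over `C` or `C^cop` is injective over the
other coalgebra, first against finite-dimensional comodules and then, by Zorn's lemma and local
finiteness, against all comodules (`exists_extend_of_finite`); it is therefore a summand of some
`C^n` (`HasCodualBasis.dualMod`). Thus every finite-dimensional comodule is a quotient of a
finite-dimensional summand of some `A^n` (`IsRightSemiperfect.exists_dualBasis`) and embeds into a
finite-dimensional summand of some `C^n` (`IsLeftSemiperfect.exists_codualBasis`), and the
finite-dimensional projectives and injectives are exactly such summands.

It remains to see that the Nakayama functors preserve finite-dimensionality, and it suffices to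
treat `C ⊗_A P` for `P` a finite-dimensional summand of `A^n`, and `Hom_A(C, E)` for `E` a
finite-dimensional summand of `C^n`. In the first case the sum of the images of all maps `P → C ⊗_A
P` is a finite-dimensional essential subcomodule, and embedding it into a finite-dimensional summand
of some `C^n` bounds all of `C ⊗_A P` (`HasDualBasis.finite_dualTensor`). Dually, the maps `C → E`
killing the image of every map `E → C` form a superfluous submodule of `Hom_A(C, E)` with
finite-dimensional rational quotient, and a finite-dimensional projective mapping onto the quotient
maps onto all of `Hom_A(C, E)` (`HasCodualBasis.finite_comodHom`). In particular `Hom_A(C, E)` is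
then its own rational part.
-/

noncomputable section

namespace Nakayama

/-! ### Comodules as rational modules -/

section Rational

variable {k : Type u} [Field k] {C : Type v} [AddCommGroup C] [Module k C] [Coalgebra k C]

/-- A right comodule as a left module over the dual algebra, with action `f • m = m₀ f(m₁)`. -/
instance comodModule {M : Type*} [AddCommGroup M] [Module k M] [RightComodule k C M] :
    Module (DualAlg k C) M where
  smul f m := leftAct f m
  one_smul := leftAct_one
  mul_smul := leftAct_mul
  smul_zero f := map_zero (leftAct f)
  smul_add f := map_add (leftAct f)
  add_smul f g m := by
    change slice M (f + g).ofConv _ = slice M f.ofConv _ + slice M g.ofConv _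
    simp [slice, LinearMap.lTensor_add]
  zero_smul m := by
    change slice M (0 : DualAlg k C).ofConv _ = 0
    simp [slice]

theorem smul_eq_leftAct {M : Type*} [AddCommGroup M] [Module k M] [RightComodule k C M]
    (f : DualAlg k C) (m : M) : f • m = leftAct f m := rfl

instance {M : Type*} [AddCommGroup M] [Module k M] [RightComodule k C M] :
    IsScalarTower k (DualAlg k C) M where
  smul_assoc r f m := by
    change slice M (r • f).ofConv _ = r • slice M f.ofConv _
    simp [slice, LinearMap.lTensor_smul]

theorem apply_smul (h f : DualAlg k C) (c : C) : h.ofConv (f • c) = (h * f).ofConv c :=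
  apply_leftAct h f c

theorem counit_smul (f : DualAlg k C) (c : C) :
    Coalgebra.counit (R := k) (f • c) = f.ofConv c := by
  have h := apply_leftAct 1 f c
  rwa [one_mul] at h

theorem counit_rightAct (f : DualAlg k C) (c : C) :
    Coalgebra.counit (R := k) (rightAct f c) = f.ofConv c := by
  have h := apply_rightAct 1 f c
  rwa [mul_one] at h

variable (k C) in
/-- A module over the dual algebra is rational if every element is annihilated by all the
functionals vanishing on some finite-dimensional subspace of `C`; by
`isRational_iff_mem_rat` this means that the module is equal to its rational part. -/
def IsRational (N : Type*) [AddCommGroup N] [Module (DualAlg k C) N] : Prop :=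
  ∀ n : N, ∃ V : Submodule k C, FiniteDimensional k V ∧
    ∀ f : DualAlg k C, (∀ v ∈ V, f.ofConv v = 0) → f • n = 0

section Transfer

variable {N : Type*} [AddCommGroup N] [Module (DualAlg k C) N]
variable {N' : Type*} [AddCommGroup N'] [Module (DualAlg k C) N']

theorem IsRational.of_injective (h : IsRational k C N') (j : N →ₗ[DualAlg k C] N')
    (hj : Function.Injective j) : IsRational k C N := fun n => by
  obtain ⟨V, hV, hf⟩ := h (j n)
  exact ⟨V, hV, fun f h0 => hj (by rw [map_smul, hf f h0, map_zero])⟩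

theorem IsRational.of_surjective (h : IsRational k C N) (p : N →ₗ[DualAlg k C] N')
    (hp : Function.Surjective p) : IsRational k C N' := fun n => by
  obtain ⟨m, rfl⟩ := hp n
  obtain ⟨V, hV, hf⟩ := h m
  exact ⟨V, hV, fun f h0 => by rw [← map_smul, hf f h0, map_zero]⟩

theorem IsRational.pi {ι : Type*} [Finite ι] (h : IsRational k C N) :
    IsRational k C (ι → N) := fun n => by
  choose V hV hf using fun i => h (n i)
  exact ⟨⨆ i, V i, inferInstance, fun f h0 => funext fun i =>
    hf i f fun v hv => h0 v (Submodule.mem_iSup_of_mem i hv)⟩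

theorem apply_toCofree (ψ : N →ₗ[DualAlg k C] C) (f : DualAlg k C) (n : N) :
    f.ofConv (ψ n) = Coalgebra.counit (R := k) (ψ (f • n)) := by
  rw [map_smul, counit_smul]

/-- A linear map into the cofree module `C` is determined by its composite with the counit. -/
theorem toCofree_ext {φ ψ : N →ₗ[DualAlg k C] C}
    (h : ∀ n, Coalgebra.counit (R := k) (φ n) = Coalgebra.counit (R := k) (ψ n)) : φ = ψ :=
  LinearMap.ext fun n => dual_ext (k := k) fun f => by rw [apply_toCofree, h, ← apply_toCofree]

end Transfer

variable {N : Type*} [AddCommGroup N] [Module k N] [Module (DualAlg k C) N]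
  [IsScalarTower k (DualAlg k C) N]
variable {N' : Type*} [AddCommGroup N'] [Module k N'] [Module (DualAlg k C) N']
  [IsScalarTower k (DualAlg k C) N']

theorem isRational_iff_mem_rat : IsRational k C N ↔ ∀ n, n ∈ rat k C N := by
  refine forall_congr' fun n => ⟨?_, ?_⟩
  · rintro ⟨V, hV, h⟩
    -- Extend the coordinate functionals of `V` to `g i` on `C`. Every `f` agrees on `V` with
    -- `∑ f(b i) g i`, so that `f • n = ∑ f(b i) g i • n`.
    let b := Module.finBasis k V
    have hb : ∀ i, ∃ g : C →ₗ[k] k, g ∘ₗ V.subtype = b.coord i :=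
      fun i => LinearMap.exists_extend (b.coord i)
    choose g hg using hb
    refine ⟨∑ i, (WithConv.toConv (g i) • n) ⊗ₜ[k] (b i : C), fun f => ?_⟩
    have key : (∑ i, f.ofConv (b i : C) • WithConv.toConv (g i) - f) • n = 0 := by
      refine h _ fun v hv => ?_
      have h1 := congrArg (fun w : V => f.ofConv (w : C)) (b.sum_repr ⟨v, hv⟩)
      simp only [Submodule.coe_sum, Submodule.coe_smul, map_sum, map_smul] at h1
      have h2 : ∀ i, g i v = b.repr ⟨v, hv⟩ i := fun i =>
        LinearMap.congr_fun (hg i) ⟨v, hv⟩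
      rw [WithConv.ofConv_sub, LinearMap.sub_apply, ← h1, sub_eq_zero]
      simp [h2, mul_comm]
    rw [sub_smul, sub_eq_zero, Finset.sum_smul] at key
    rw [← key]
    simp
  · rintro ⟨t, ht⟩
    obtain ⟨ι, b, g, s, hs⟩ := exists_expansion t
    classical
    refine ⟨Submodule.span k (s.image b), inferInstance, fun f hf => ?_⟩
    rw [← ht f, hs, map_sum]
    refine Finset.sum_eq_zero fun i hi => ?_
    rw [slice_tmul, hf _ (Submodule.subset_span (by simpa using ⟨i, hi, rfl⟩)), zero_smul]

variable (k C) in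
theorem isRational_comodule (M : Type*) [AddCommGroup M] [Module k M] [RightComodule k C M] :
    IsRational k C M :=
  isRational_iff_mem_rat.2 fun m => ⟨RightComodule.coact m, fun _ => rfl⟩


theorem IsRational.exists_tensor (h : IsRational k C N) (n : N) :
    ∃ t : N ⊗[k] C, ∀ f : DualAlg k C, slice N f.ofConv t = f • n :=
  isRational_iff_mem_rat.1 h n

/-- A finite-dimensional rational module is annihilated by all functionals that vanish on one
finite-dimensional subspace of `C`. -/
theorem IsRational.exists_uniform (h : IsRational k C N) [FiniteDimensional k N] :
    ∃ V : Submodule k C, FiniteDimensional k V ∧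
      ∀ f : DualAlg k C, (∀ v ∈ V, f.ofConv v = 0) → ∀ n : N, f • n = 0 := by
  let b := Module.finBasis k N
  choose V hV hf using fun i => h (b i)
  refine ⟨⨆ i, V i, inferInstance, fun f h0 n => ?_⟩
  rw [← b.sum_repr n, Finset.smul_sum]
  refine Finset.sum_eq_zero fun i _ => ?_
  rw [smul_comm, hf i f fun v hv => h0 v (Submodule.mem_iSup_of_mem i hv), smul_zero]

/-- Rational modules are locally finite. -/
theorem IsRational.finite_of_fg (h : IsRational k C N) (S : Submodule (DualAlg k C) N)
    (hS : S.FG) : FiniteDimensional k S := by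
  induction S, hS using Submodule.fg_induction with
  | singleton x =>
    obtain ⟨t, ht⟩ := h.exists_tensor x
    obtain ⟨ι, b, g, s, hs⟩ := exists_expansion t
    classical
    have hle : ((DualAlg k C) ∙ x).restrictScalars k ≤
        Submodule.span k (s.image fun i => slice N (g i) t : Finset N) := by
      rintro y hy
      obtain ⟨f, rfl⟩ := Submodule.mem_span_singleton.1 hy
      rw [← ht f, hs, map_sum]
      refine Submodule.sum_mem _ fun i hi => ?_
      rw [slice_tmul, ← hs]
      exact Submodule.smul_mem _ _ (Submodule.subset_span (by simpa using ⟨i, hi, rfl⟩))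
    exact Submodule.finiteDimensional_of_le hle
  | sup S T _ _ hS hT =>
    have hsurj : Function.Surjective ((Submodule.inclusion (le_sup_left : S ≤ S ⊔ T)).coprod
        (Submodule.inclusion (le_sup_right : T ≤ S ⊔ T))) := by
      rintro ⟨x, hx⟩
      obtain ⟨y, hy, z, hz, rfl⟩ := Submodule.mem_sup.1 hx
      exact ⟨(⟨y, hy⟩, ⟨z, hz⟩), rfl⟩
    exact Module.Finite.of_surjective (LinearMap.restrictScalars k
      ((Submodule.inclusion (le_sup_left : S ≤ S ⊔ T)).coprod
        (Submodule.inclusion (le_sup_right : T ≤ S ⊔ T)))) hsurj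

/-- The functional `g` on a rational module `N` determines the linear map
`n ↦ g(n₀) n₁` into the cofree module `C`. -/
theorem IsRational.exists_cofree (h : IsRational k C N) (g : N →ₗ[k] k) :
    ∃ ψ : N →ₗ[DualAlg k C] C, ∀ (f : DualAlg k C) (n : N), f.ofConv (ψ n) = g (f • n) := by
  have key : ∀ n : N, ∃ c : C, ∀ f : DualAlg k C, f.ofConv c = g (f • n) := fun n => by
    obtain ⟨t, ht⟩ := h.exists_tensor n
    refine ⟨TensorProduct.lid k C (g.rTensor C t), fun f => ?_⟩
    rw [← ht f]
    generalize t = w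
    induction w with
    | zero => simp
    | add x y hx hy => simp only [map_add, hx, hy]
    | tmul x y => simp [mul_comm]
  choose ψ hψ using key
  refine ⟨{ toFun := ψ, map_add' := fun a b => dual_ext (k := k) fun f => ?_,
            map_smul' := fun r a => dual_ext (k := k) fun f => ?_ }, fun f n => hψ n f⟩
  · rw [map_add, hψ, hψ, hψ, smul_add, map_add]
  · rw [hψ, RingHom.id_apply, apply_smul, hψ, mul_smul]

/-- The cofree module `C` is injective among rational modules. -/
theorem IsRational.exists_extend_cofree (h : IsRational k C N') (j : N →ₗ[DualAlg k C] N')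
    (hj : Function.Injective j) (φ : N →ₗ[DualAlg k C] C) :
    ∃ ψ : N' →ₗ[DualAlg k C] C, ∀ n, ψ (j n) = φ n := by
  obtain ⟨r, hr⟩ := (j.restrictScalars k).exists_leftInverse_of_injective
    (LinearMap.ker_eq_bot.2 hj)
  obtain ⟨ψ, hψ⟩ := h.exists_cofree
    (Coalgebra.counit (R := k) (A := C) ∘ₗ φ.restrictScalars k ∘ₗ r)
  refine ⟨ψ, fun n => LinearMap.congr_fun (f := ψ ∘ₗ j) (g := φ) (toCofree_ext fun n => ?_) n⟩
  have h1 := hψ 1 (j n)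
  rw [one_smul] at h1
  have h2 : r (j n) = n := LinearMap.congr_fun hr n
  simpa [h2] using h1

/-- The space of linear maps from a finite-dimensional module to `C` is finite-dimensional. -/
theorem finite_toCofree [FiniteDimensional k N] :
    FiniteDimensional k (N →ₗ[DualAlg k C] C) :=
  Module.Finite.of_injective
    ({ toFun := fun φ => Coalgebra.counit (R := k) (A := C) ∘ₗ φ.restrictScalars k
       map_add' := fun φ ψ => by ext; simp
       map_smul' := fun r φ => by ext; simp } : (N →ₗ[DualAlg k C] C) →ₗ[k] (N →ₗ[k] k))
    fun _ _ h => toCofree_ext fun n => LinearMap.congr_fun h n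

/-- The comodule structure on a rational module. -/
@[reducible] def IsRational.rightComodule (h : IsRational k C N) : RightComodule k C N :=
  RightComodule.ofSlice
    ({ toFun := fun n => (h.exists_tensor n).choose
       map_add' := fun a b => slice_ext fun f => by
        have h1 := fun n => (h.exists_tensor n).choose_spec (WithConv.toConv f)
        simp only at h1
        rw [map_add, h1, h1, h1, smul_add]
       map_smul' := fun r a => slice_ext fun f => by
        have h1 := fun n => (h.exists_tensor n).choose_spec (WithConv.toConv f)
        simp only at h1
        rw [map_smul, h1, h1, RingHom.id_apply, smul_comm] } : N →ₗ[k] N ⊗[k] C)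
    (fun f g n => by
      have h1 := fun n => (h.exists_tensor n).choose_spec
      simp only [LinearMap.coe_mk, AddHom.coe_mk, h1, mul_smul])
    (fun n => ((h.exists_tensor n).choose_spec 1).trans (one_smul _ n))

end Rational

section Category

variable {k : Type u} [Field k] {C : Type v} [AddCommGroup C] [Module k C] [Coalgebra k C]

/-- A rational module as an object of the category of comodules. -/
def IsRational.comod {N : Type v} [AddCommGroup N] [Module k N] [Module (DualAlg k C) N]
    [IsScalarTower k (DualAlg k C) N] (h : IsRational k C N) : Comod k C :=
  letI := h.rightComodule
  ⟨N⟩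

/-- The identity map between a rational module and its comodule, whose coaction induces the given
action of the dual algebra. -/
def IsRational.equiv {N : Type v} [AddCommGroup N] [Module k N] [Module (DualAlg k C) N]
    [IsScalarTower k (DualAlg k C) N] (h : IsRational k C N) : N ≃ₗ[DualAlg k C] h.comod where
  toFun n := n
  invFun n := n
  map_add' _ _ := rfl
  map_smul' f n := ((h.exists_tensor n).choose_spec f).symm
  left_inv _ := rfl
  right_inv _ := rfl

/-- A colinear map is linear over the dual algebra. -/
def linOfHom {M M' : Comod k C} (φ : M ⟶ M') : M →ₗ[DualAlg k C] M' where
  toFun := φ.1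
  map_add' := map_add φ.1
  map_smul' f m := (mem_comodHom_iff φ.1).1 φ.2 f m

/-- A map of comodules that is linear over the dual algebra is colinear. -/
def homOfLin {M M' : Comod k C} (φ : M →ₗ[DualAlg k C] M') : M ⟶ M' :=
  ⟨φ.restrictScalars k, (mem_comodHom_iff _).2 fun f m => map_smul φ f m⟩

theorem comod_hom_ext {M M' : Comod k C} {φ ψ : M ⟶ M'} (h : ∀ m, φ.1 m = ψ.1 m) : φ = ψ :=
  Subtype.ext (LinearMap.ext h)

theorem comod_epi_of_surjective {M M' : Comod k C} (φ : M ⟶ M')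
    (h : Function.Surjective φ.1) : Epi φ :=
  ⟨fun _ _ hαβ => comod_hom_ext fun x => by
    obtain ⟨m, rfl⟩ := h x
    exact LinearMap.congr_fun (congrArg Subtype.val hαβ) m⟩

/-- A colinear map that is not surjective is equalised by the two distinct maps to its cokernel,
the projection and zero. -/
theorem exists_cokernel_pair {M M' : Comod k C} (φ : M ⟶ M') :
    ∃ (X : Comod k C) (α β : M' ⟶ X), (FiniteDimensional k M' → FiniteDimensional k X) ∧
      φ ≫ α = φ ≫ β ∧ (α = β → Function.Surjective φ.1) := by
  let R := LinearMap.range (linOfHom φ)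
  have hR : IsRational k C (M' ⧸ R) :=
    (isRational_comodule k C M').of_surjective R.mkQ R.mkQ_surjective
  let q : M' →ₗ[DualAlg k C] hR.comod := hR.equiv.toLinearMap ∘ₗ R.mkQ
  refine ⟨hR.comod, homOfLin q, homOfLin 0, fun _ => ?_, ?_, fun h y => ?_⟩
  · exact Module.Finite.of_surjective (q.restrictScalars k)
      (hR.equiv.surjective.comp R.mkQ_surjective)
  · refine comod_hom_ext fun m => ?_
    exact hR.equiv.map_eq_zero_iff.2 ((Submodule.Quotient.mk_eq_zero R).2 ⟨m, rfl⟩)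
  · have h1 : q y = 0 := LinearMap.congr_fun (congrArg Subtype.val h) y
    exact (Submodule.Quotient.mk_eq_zero R).1 (hR.equiv.map_eq_zero_iff.1 h1)

/-- A colinear map that is not injective equalises the two distinct maps from its kernel, the
inclusion and zero. -/
theorem exists_kernel_pair {M M' : Comod k C} (φ : M ⟶ M') :
    ∃ (X : Comod k C) (α β : X ⟶ M), (FiniteDimensional k M → FiniteDimensional k X) ∧
      α ≫ φ = β ≫ φ ∧ (α = β → Function.Injective φ.1) := by
  let R := LinearMap.ker (linOfHom φ)
  have hR : IsRational k C R :=
    (isRational_comodule k C M).of_injective R.subtype R.subtype_injective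
  let q : hR.comod →ₗ[DualAlg k C] M := R.subtype ∘ₗ hR.equiv.symm.toLinearMap
  refine ⟨hR.comod, homOfLin q, homOfLin 0, fun _ => ?_, ?_, fun h => ?_⟩
  · exact Module.Finite.of_injective (q.restrictScalars k)
      (R.subtype_injective.comp hR.equiv.symm.injective)
  · exact comod_hom_ext fun m => ((hR.equiv.symm m).2.trans (map_zero (linOfHom φ)).symm)
  · refine (injective_iff_map_eq_zero φ.1).2 fun x hx => ?_
    exact LinearMap.congr_fun (congrArg Subtype.val h) (hR.equiv ⟨x, hx⟩)

theorem comod_surjective_of_epi {M M' : Comod k C} (φ : M ⟶ M') [Epi φ] :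
    Function.Surjective φ.1 := by
  obtain ⟨X, α, β, -, h1, h2⟩ := exists_cokernel_pair φ
  exact h2 ((cancel_epi φ).1 h1)

theorem fdComod_surjective_of_epi {M M' : FdComod k C} (φ : M ⟶ M') [Epi φ] :
    Function.Surjective φ.hom.1 := by
  obtain ⟨X, α, β, hX, h1, h2⟩ := exists_cokernel_pair φ.hom
  let X' : FdComod k C := ⟨X, hX M'.property⟩
  have h3 : (ObjectProperty.homMk α : M' ⟶ X') = ObjectProperty.homMk β :=
    (cancel_epi φ).1 (ObjectProperty.hom_ext _ h1)
  exact h2 (congrArg (fun f => f.hom) h3)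

theorem fdComod_injective_of_mono {M M' : FdComod k C} (φ : M ⟶ M') [Mono φ] :
    Function.Injective φ.hom.1 := by
  obtain ⟨X, α, β, hX, h1, h2⟩ := exists_kernel_pair φ.hom
  let X' : FdComod k C := ⟨X, hX M.property⟩
  have h3 : (ObjectProperty.homMk α : X' ⟶ M) = ObjectProperty.homMk β :=
    (cancel_mono φ).1 (ObjectProperty.hom_ext _ h1)
  exact h2 (congrArg (fun f => f.hom) h3)

theorem fdComod_epi_of_surjective {M M' : FdComod k C} (φ : M ⟶ M')
    (h : Function.Surjective φ.hom.1) : Epi φ :=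
  ⟨fun _ _ hαβ => ObjectProperty.hom_ext _ (comod_hom_ext fun x => by
    obtain ⟨m, rfl⟩ := h x
    exact LinearMap.congr_fun (congrArg (fun f => f.hom.1) hαβ) m)⟩

theorem fdComod_mono_of_injective {M M' : FdComod k C} (φ : M ⟶ M')
    (h : Function.Injective φ.hom.1) : Mono φ :=
  ⟨fun _ _ hαβ => ObjectProperty.hom_ext _ (comod_hom_ext fun x =>
    h (LinearMap.congr_fun (congrArg (fun f => f.hom.1) hαβ) x))⟩

/-- A bijective colinear map is an isomorphism. -/
theorem comod_isIso_of_bijective {M M' : Comod k C} (φ : M ⟶ M')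
    (h : Function.Bijective φ.1) : IsIso φ := by
  let e := LinearEquiv.ofBijective (linOfHom φ) h
  exact ⟨homOfLin e.symm.toLinearMap, comod_hom_ext e.symm_apply_apply,
    comod_hom_ext e.apply_symm_apply⟩

end Category

/-! ### Modules with a dual or a codual basis -/

section DualBasis

variable {k : Type u} [Field k] {C : Type v} [AddCommGroup C] [Module k C] [Coalgebra k C]

variable (k C) in
/-- A module over the dual algebra `A = C^*` has a finite dual basis if it is a direct summand of
some `A^n`; equivalently, it is finitely generated and projective. -/
def HasDualBasis (P : Type*) [AddCommGroup P] [Module (DualAlg k C) P] : Prop :=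
  ∃ (n : ℕ) (p : Fin n → P) (π : Fin n → P →ₗ[DualAlg k C] DualAlg k C),
    ∀ x, ∑ i, π i x • p i = x

variable (k C) in
/-- A module over the dual algebra of `C` has a finite codual basis if it is a direct summand of
some `C^n`. -/
def HasCodualBasis (E : Type*) [AddCommGroup E] [Module (DualAlg k C) E] : Prop :=
  ∃ (n : ℕ) (ι : Fin n → E →ₗ[DualAlg k C] C) (ρ : Fin n → C →ₗ[DualAlg k C] E),
    ∀ x, ∑ i, ρ i (ι i x) = x

section

variable {P : Type*} [AddCommGroup P] [Module (DualAlg k C) P]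
variable {X : Type*} [AddCommGroup X] [Module (DualAlg k C) X]
variable {Y : Type*} [AddCommGroup Y] [Module (DualAlg k C) Y]

theorem HasDualBasis.retract (h : HasDualBasis k C P) (i : X →ₗ[DualAlg k C] P)
    (r : P →ₗ[DualAlg k C] X) (hr : ∀ x, r (i x) = x) : HasDualBasis k C X := by
  obtain ⟨n, p, π, hp⟩ := h
  refine ⟨n, fun a => r (p a), fun a => π a ∘ₗ i, fun x => ?_⟩
  simp only [LinearMap.comp_apply, ← map_smul, ← map_sum, hp, hr]

theorem HasCodualBasis.retract (h : HasCodualBasis k C P) (i : X →ₗ[DualAlg k C] P)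
    (r : P →ₗ[DualAlg k C] X) (hr : ∀ x, r (i x) = x) : HasCodualBasis k C X := by
  obtain ⟨n, ι, ρ, hp⟩ := h
  refine ⟨n, fun a => ι a ∘ₗ i, fun a => r ∘ₗ ρ a, fun x => ?_⟩
  simp only [LinearMap.comp_apply, ← map_sum, hp, hr]

theorem HasDualBasis.exists_lift (h : HasDualBasis k C P) (q : Y →ₗ[DualAlg k C] X)
    (hq : Function.Surjective q) (φ : P →ₗ[DualAlg k C] X) :
    ∃ ψ : P →ₗ[DualAlg k C] Y, ∀ x, q (ψ x) = φ x := by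
  obtain ⟨n, p, π, hp⟩ := h
  choose y hy using fun i => hq (φ (p i))
  refine ⟨∑ i, (LinearMap.toSpanSingleton (DualAlg k C) Y (y i)) ∘ₗ π i, fun x => ?_⟩
  simp only [LinearMap.sum_apply, LinearMap.comp_apply, LinearMap.toSpanSingleton_apply, map_sum,
    map_smul, hy]
  conv_rhs => rw [← hp x, map_sum]
  simp only [map_smul]

theorem HasCodualBasis.exists_extend [Module k X] [Module k Y]
    [IsScalarTower k (DualAlg k C) X] [IsScalarTower k (DualAlg k C) Y]
    (h : HasCodualBasis k C P) (hY : IsRational k C Y)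
    (j : X →ₗ[DualAlg k C] Y) (hj : Function.Injective j) (φ : X →ₗ[DualAlg k C] P) :
    ∃ ψ : Y →ₗ[DualAlg k C] P, ∀ x, ψ (j x) = φ x := by
  obtain ⟨n, ι, ρ, hp⟩ := h
  choose ψ hψ using fun i => hY.exists_extend_cofree j hj (ι i ∘ₗ φ)
  refine ⟨∑ i, ρ i ∘ₗ ψ i, fun x => ?_⟩
  simp only [LinearMap.sum_apply, LinearMap.comp_apply, hψ, hp]

end

/-- A finite-dimensional comodule with a dual basis is projective among the finite-dimensional
comodules. -/
theorem HasDualBasis.projective {P : FdComod k C} (h : HasDualBasis k C P.obj) : Projective P where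
  factors {E X} f e _ := by
    obtain ⟨ψ, hψ⟩ := h.exists_lift (linOfHom e.hom) (fdComod_surjective_of_epi e) (linOfHom f.hom)
    exact ⟨ObjectProperty.homMk (homOfLin ψ), ObjectProperty.hom_ext _ (comod_hom_ext hψ)⟩

/-- A finite-dimensional comodule with a codual basis is injective among the finite-dimensional
comodules. -/
theorem HasCodualBasis.injective {P : FdComod k C} (h : HasCodualBasis k C P.obj) :
    Injective P where
  factors {X Y} g f _ := by
    obtain ⟨ψ, hψ⟩ := h.exists_extend (isRational_comodule k C Y.obj)
      (linOfHom f.hom) (fdComod_injective_of_mono f) (linOfHom g.hom)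
    exact ⟨ObjectProperty.homMk (homOfLin ψ), ObjectProperty.hom_ext _ (comod_hom_ext hψ)⟩

/-- If every map into `E` from a submodule of a finite-dimensional rational module extends, then so
does every map into `E` from a submodule of an arbitrary rational module: a maximal partial
extension is total, since rational modules are locally finite. -/
theorem exists_extend_of_finite {E : Type*} [AddCommGroup E] [Module (DualAlg k C) E]
    (hE : ∀ (Y : Type v) [AddCommGroup Y] [Module k Y] [Module (DualAlg k C) Y]
      [IsScalarTower k (DualAlg k C) Y], IsRational k C Y → FiniteDimensional k Y →
      ∀ (X : Submodule (DualAlg k C) Y) (φ : X →ₗ[DualAlg k C] E),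
        ∃ ψ : Y →ₗ[DualAlg k C] E, ∀ x : X, ψ x = φ x)
    {Y : Type v} [AddCommGroup Y] [Module k Y] [Module (DualAlg k C) Y]
    [IsScalarTower k (DualAlg k C) Y] (hY : IsRational k C Y)
    (X : Submodule (DualAlg k C) Y) (φ : X →ₗ[DualAlg k C] E) :
    ∃ ψ : Y →ₗ[DualAlg k C] E, ∀ x : X, ψ x = φ x := by
  obtain ⟨m, hm, hmax⟩ := zorn_le_nonempty_Ici₀ (⟨X, φ⟩ : Y →ₗ.[DualAlg k C] E)
    (fun c _ hc _ _ => ⟨LinearPMap.sSup c hc.directedOn, fun z hz => LinearPMap.le_sSup _ hz⟩)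
    _ le_rfl
  have htop : ∀ y, y ∈ m.domain := by
    intro y
    let F : Submodule (DualAlg k C) Y := (DualAlg k C) ∙ y
    have hF : FiniteDimensional k F := hY.finite_of_fg F (Submodule.fg_span_singleton y)
    obtain ⟨ψ, hψ⟩ := hE F (hY.of_injective F.subtype F.subtype_injective) hF
      (m.domain.comap F.subtype)
      (m.toFun ∘ₗ (F.subtype.restrict (p := m.domain.comap F.subtype) (q := m.domain)
        fun _ hx => hx))
    -- `m` and an extension `ψ` to `F` of its restriction to `F ∩ m.domain` glue.
    have hcompat : ∀ (x : m.domain) (z : F), (x : Y) = z → m x = ψ z := fun x z hxz => by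
      have h1 := hψ ⟨z, by rw [Submodule.mem_comap, Submodule.subtype_apply, ← hxz]; exact x.2⟩
      refine Eq.trans ?_ h1.symm
      exact congrArg m (Subtype.ext hxz)
    have hle := hmax (LinearPMap.left_le_sup m ⟨F, ψ⟩ hcompat)
    exact hle.1 ((LinearPMap.right_le_sup m ⟨F, ψ⟩ hcompat).1
      (Submodule.mem_span_singleton_self y))
  refine ⟨m.toFun ∘ₗ LinearMap.id.codRestrict m.domain htop, fun x => ?_⟩
  exact (hm.2 (x := x) (y := ⟨x, htop x⟩) rfl).symm

/-- A finite-dimensional rational module that is injective among the finite-dimensional rational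
modules is a direct summand of some `C^n`. -/
theorem HasCodualBasis.of_extends {E : Type*} [AddCommGroup E] [Module k E]
    [Module (DualAlg k C) E] [IsScalarTower k (DualAlg k C) E] [FiniteDimensional k E]
    (hrat : IsRational k C E)
    (hE : ∀ (Y : Type v) [AddCommGroup Y] [Module k Y] [Module (DualAlg k C) Y]
      [IsScalarTower k (DualAlg k C) Y], IsRational k C Y → FiniteDimensional k Y →
      ∀ (X : Submodule (DualAlg k C) Y) (φ : X →ₗ[DualAlg k C] E),
        ∃ ψ : Y →ₗ[DualAlg k C] E, ∀ x : X, ψ x = φ x) :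
    HasCodualBasis k C E := by
  classical
  let b := Module.finBasis k E
  choose ι hι using fun i => hrat.exists_cofree (b.coord i)
  -- `E` embeds into `C^n`, one copy of `C` for each element of a basis of the dual space.
  let j : E →ₗ[DualAlg k C] (Fin (Module.finrank k E) → C) := LinearMap.pi ι
  have hj : Function.Injective j := fun x y hxy => b.ext_elem fun i => by
    have h1 := hι i 1 x
    have h2 := hι i 1 y
    rw [one_smul] at h1 h2
    rw [← Module.Basis.coord_apply, ← Module.Basis.coord_apply, ← h1, ← h2]
    exact congrArg _ (congrFun hxy i)
  let e := LinearEquiv.ofInjective j hj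
  obtain ⟨ψ, hψ⟩ := exists_extend_of_finite hE (IsRational.pi (isRational_comodule k C C))
    (LinearMap.range j) e.symm.toLinearMap
  refine ⟨_, ι, fun i => ψ ∘ₗ LinearMap.single (DualAlg k C) (fun _ => C) i, fun x => ?_⟩
  simp only [LinearMap.comp_apply]
  rw [← map_sum]
  exact (congrArg ψ (Finset.univ_sum_single (j x))).trans ((hψ (e x)).trans (e.symm_apply_apply x))

end DualBasis

/-! ### Duality between the comodules of `C` and of `C^cop` -/

section Flip

variable (k : Type u) [Field k] (C : Type v) [AddCommGroup C] [Module k C] [Coalgebra k C]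
variable (D : Type v) [AddCommGroup D] [Module k D] [Coalgebra k D]

/-- An anti-isomorphism of coalgebras, recorded through the anti-homomorphism
`f ↦ f ∘ τ` that it induces on the dual algebras. -/
structure CoalgFlip where
  /-- the underlying linear equivalence -/
  toEquiv : C ≃ₗ[k] D
  /-- precomposition reverses convolution products -/
  map_mul' : ∀ f g : DualAlg k D, WithConv.toConv ((f * g).ofConv ∘ₗ toEquiv.toLinearMap) =
    (WithConv.toConv (g.ofConv ∘ₗ toEquiv.toLinearMap) *
      WithConv.toConv (f.ofConv ∘ₗ toEquiv.toLinearMap) : DualAlg k C)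
  /-- precomposition preserves the counit -/
  map_one' : WithConv.toConv ((1 : DualAlg k D).ofConv ∘ₗ toEquiv.toLinearMap) =
    (1 : DualAlg k C)

variable {k C D}

namespace CoalgFlip

/-- The map `f ↦ f ∘ τ` between the dual algebras. -/
def pull (τ : CoalgFlip k C D) : DualAlg k D →ₗ[k] DualAlg k C where
  toFun f := WithConv.toConv (f.ofConv ∘ₗ τ.toEquiv.toLinearMap)
  map_add' _ _ := rfl
  map_smul' _ _ := rfl

theorem pull_apply (τ : CoalgFlip k C D) (f : DualAlg k D) (c : C) :
    (τ.pull f).ofConv c = f.ofConv (τ.toEquiv c) := rfl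

theorem pull_mul (τ : CoalgFlip k C D) (f g : DualAlg k D) :
    τ.pull (f * g) = τ.pull g * τ.pull f := τ.map_mul' f g

theorem pull_one (τ : CoalgFlip k C D) : τ.pull 1 = 1 := τ.map_one'

theorem pull_injective (τ : CoalgFlip k C D) : Function.Injective τ.pull := fun f g h => by
  refine WithConv.ofConv_injective (LinearMap.ext fun d => ?_)
  have h1 := congrArg (fun w : DualAlg k C => w.ofConv (τ.toEquiv.symm d)) h
  simpa [pull_apply] using h1

theorem pull_symm_aux (τ : CoalgFlip k C D) (f : DualAlg k C) :
    τ.pull (WithConv.toConv (f.ofConv ∘ₗ τ.toEquiv.symm.toLinearMap)) = f := by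
  refine WithConv.ofConv_injective (LinearMap.ext fun d => ?_)
  simp [pull_apply]

/-- The inverse anti-isomorphism. -/
def symm (τ : CoalgFlip k C D) : CoalgFlip k D C where
  toEquiv := τ.toEquiv.symm
  map_mul' f g := τ.pull_injective (by rw [pull_mul]; simp only [pull_symm_aux])
  map_one' := τ.pull_injective (by rw [pull_one]; simp only [pull_symm_aux])

theorem pull_pull_symm (τ : CoalgFlip k C D) (f : DualAlg k C) : τ.pull (τ.symm.pull f) = f :=
  pull_symm_aux τ f

theorem pull_symm_pull (τ : CoalgFlip k C D) (f : DualAlg k D) : τ.symm.pull (τ.pull f) = f :=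
  τ.pull_injective (τ.pull_pull_symm _)

/-- An anti-isomorphism turns the left action into the right action. -/
theorem smul_toEquiv (τ : CoalgFlip k C D) (f : DualAlg k D) (c : C) :
    f • τ.toEquiv c = τ.toEquiv (rightAct (τ.pull f) c) := by
  refine dual_ext (k := k) fun g => ?_
  rw [apply_smul, ← pull_apply, ← pull_apply, pull_mul, apply_rightAct]

end CoalgFlip

variable (k C) in
/-- The identity map as an anti-isomorphism from `C` to `C^cop`. -/
def copFlip : CoalgFlip k C (Cop C) where
  toEquiv := (LinearEquiv.refl k C : C ≃ₗ[k] C)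
  map_mul' f g := by
    refine WithConv.ofConv_injective (LinearMap.ext fun c => ?_)
    have key : ∀ (f g : C →ₗ[k] k) (w : C ⊗[k] C), LinearMap.mul' k k (TensorProduct.map f g
        (TensorProduct.comm k C C w)) = LinearMap.mul' k k (TensorProduct.map g f w) := by
      intro f g w
      induction w with
      | zero => simp
      | add x y hx hy => simp only [map_add, hx, hy]
      | tmul x y => simp [mul_comm]
    exact key f.ofConv g.ofConv _
  map_one' := rfl

/-- The linear dual of a module over the dual algebra of `C`, as a module over the dual algebra
of the anti-isomorphic coalgebra `D`. The anti-isomorphism is an argument of the type because the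
action depends on it. -/
def DualMod (_ : CoalgFlip k C D) (M : Type*) [AddCommGroup M] [Module k M] := Module.Dual k M

section DualMod

variable (τ : CoalgFlip k C D) {M : Type*} [AddCommGroup M] [Module k M]

instance : AddCommGroup (DualMod τ M) := inferInstanceAs (AddCommGroup (Module.Dual k M))

instance : Module k (DualMod τ M) := inferInstanceAs (Module k (Module.Dual k M))

instance [FiniteDimensional k M] : FiniteDimensional k (DualMod τ M) :=
  inferInstanceAs (FiniteDimensional k (Module.Dual k M))

instance : FunLike (DualMod τ M) M k := inferInstanceAs (FunLike (Module.Dual k M) M k)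

instance : LinearMapClass (DualMod τ M) k M k :=
  inferInstanceAs (LinearMapClass (Module.Dual k M) k M k)

variable {τ} in
@[ext] theorem DualMod.ext {g h : DualMod τ M} (H : ∀ m, g m = h m) : g = h := LinearMap.ext H

theorem DualMod.zero_apply (m : M) : (0 : DualMod τ M) m = 0 := rfl

theorem DualMod.kSMul_apply (r : k) (g : DualMod τ M) (m : M) : (r • g) m = r * g m := rfl

/-- The dual of a finite-dimensional space in the universe of `C` lives in the universe
`max u v`, but it is isomorphic to the space itself. -/
theorem small_dualMod {M : Type v} [AddCommGroup M] [Module k M] [FiniteDimensional k M] :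
    Small.{v} (DualMod τ M) := by
  classical
  exact Small.mk' (Module.finBasis k M).toDualEquiv.toEquiv.symm

variable [Module (DualAlg k C) M] [IsScalarTower k (DualAlg k C) M]

instance : SMul (DualAlg k D) (DualMod τ M) where
  smul f g := (show Module.Dual k M from g) ∘ₗ DistribSMul.toLinearMap k M (τ.pull f)

theorem DualMod.smul_apply (f : DualAlg k D) (g : DualMod τ M) (m : M) :
    (f • g) m = g (τ.pull f • m) := rfl

instance : Module (DualAlg k D) (DualMod τ M) where
  one_smul g := DualMod.ext fun m => by rw [DualMod.smul_apply, τ.pull_one, one_smul]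
  mul_smul f f' g := DualMod.ext fun m => by
    rw [DualMod.smul_apply, τ.pull_mul, mul_smul, ← DualMod.smul_apply, ← DualMod.smul_apply]
  smul_zero f := DualMod.ext fun m => rfl
  smul_add f g h := DualMod.ext fun m => rfl
  add_smul f f' g := DualMod.ext fun m => by
    rw [DualMod.smul_apply, map_add, add_smul, map_add]; rfl
  zero_smul g := DualMod.ext fun m => by
    have h : τ.pull 0 = 0 := map_zero τ.pull
    rw [DualMod.smul_apply, h, zero_smul (DualAlg k C) m, map_zero, DualMod.zero_apply]

instance : IsScalarTower k (DualAlg k D) (DualMod τ M) where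
  smul_assoc r f g := DualMod.ext fun m => by
    rw [DualMod.smul_apply, DualMod.kSMul_apply, DualMod.smul_apply,
      show τ.pull (r • f) = r • τ.pull f from rfl, smul_assoc]
    exact map_smul (show Module.Dual k M from g) r _

/-- The dual of a finite-dimensional rational module is rational. -/
theorem IsRational.dualMod [FiniteDimensional k M] (h : IsRational k C M) :
    IsRational k D (DualMod τ M) := fun g => by
  obtain ⟨V, hV, hf⟩ := h.exists_uniform
  refine ⟨V.map τ.toEquiv.toLinearMap, inferInstance, fun f h0 => DualMod.ext fun m => ?_⟩
  rw [DualMod.smul_apply, hf (τ.pull f) (fun v hv => h0 _ (Submodule.mem_map_of_mem hv)) m,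
    map_zero, DualMod.zero_apply]

end DualMod

end Flip

section Small

variable {k : Type u} [Field k] {C : Type v} [AddCommGroup C] [Module k C] [Coalgebra k C]
variable {X : Type*} [AddCommGroup X] [Module k X] [Module (DualAlg k C) X]
  [IsScalarTower k (DualAlg k C) X] [Small.{v} X]

instance : IsScalarTower k (DualAlg k C) (Shrink.{v} X) where
  smul_assoc r f x := (Shrink.linearEquiv k X).injective (by
    refine Eq.trans ?_ ((Shrink.linearEquiv k X).map_smul r (f • x)).symm
    change Shrink.linearEquiv (DualAlg k C) X ((r • f) • x) =
      r • Shrink.linearEquiv (DualAlg k C) X (f • x)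
    rw [map_smul, map_smul, smul_assoc])

theorem IsRational.shrink {X : Type*} [AddCommGroup X] [Module (DualAlg k C) X] [Small.{v} X]
    (h : IsRational k C X) : IsRational k C (Shrink.{v} X) :=
  h.of_injective (Shrink.linearEquiv (DualAlg k C) X).toLinearMap
    (Shrink.linearEquiv (DualAlg k C) X).injective

/-- A small rational module as a comodule in the universe of `C`. -/
def IsRational.shrinkComod (h : IsRational k C X) : Comod k C := h.shrink.comod

/-- The isomorphism between a small rational module and its comodule in the universe of `C`. -/
def IsRational.shrinkEquiv (h : IsRational k C X) : X ≃ₗ[DualAlg k C] h.shrinkComod :=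
  (Shrink.linearEquiv (DualAlg k C) X).symm ≪≫ₗ h.shrink.equiv

instance (h : IsRational k C X) [FiniteDimensional k X] : FiniteDimensional k h.shrinkComod :=
  Module.Finite.of_surjective (h.shrinkEquiv.toLinearMap.restrictScalars k) h.shrinkEquiv.surjective

/-- A projective comodule lifts against surjections between small rational modules. -/
theorem exists_lift_of_projective {P : Comod k C} [Projective P] {Y : Type*} [AddCommGroup Y]
    [Module k Y] [Module (DualAlg k C) Y] [IsScalarTower k (DualAlg k C) Y] [Small.{v} Y]
    (hX : IsRational k C X) (hY : IsRational k C Y)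
    (q : Y →ₗ[DualAlg k C] X) (hq : Function.Surjective q) (φ : P →ₗ[DualAlg k C] X) :
    ∃ ψ : P →ₗ[DualAlg k C] Y, ∀ x, q (ψ x) = φ x := by
  let e := hX.shrinkEquiv
  let e' := hY.shrinkEquiv
  let q' : hY.shrinkComod ⟶ hX.shrinkComod :=
    homOfLin (e.toLinearMap ∘ₗ q ∘ₗ e'.symm.toLinearMap)
  let φ' : P ⟶ hX.shrinkComod := homOfLin (e.toLinearMap ∘ₗ φ)
  have : Epi q' := comod_epi_of_surjective _
    (e.surjective.comp (hq.comp e'.symm.surjective))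
  have h := Projective.factorThru_comp φ' q'
  refine ⟨e'.symm.toLinearMap ∘ₗ linOfHom (Projective.factorThru φ' q'), fun x => e.injective ?_⟩
  exact LinearMap.congr_fun (congrArg Subtype.val h) x

end Small

section Duality

variable {k : Type u} [Field k] {C : Type v} [AddCommGroup C] [Module k C] [Coalgebra k C]
variable {D : Type v} [AddCommGroup D] [Module k D] [Coalgebra k D]

/-- The transpose of a linear map from `M` into the dual of `Q` is a linear map from `Q` into the
dual of `M`. -/
def DualMod.transpose (τ : CoalgFlip k C D) (σ : CoalgFlip k D C)
    (h : ∀ f, σ.pull (τ.pull f) = f) {M : Type*} [AddCommGroup M] [Module k M]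
    [Module (DualAlg k C) M] [IsScalarTower k (DualAlg k C) M] {Q : Type*} [AddCommGroup Q]
    [Module k Q] [Module (DualAlg k D) Q] [IsScalarTower k (DualAlg k D) Q]
    (φ : M →ₗ[DualAlg k C] DualMod σ Q) : Q →ₗ[DualAlg k D] DualMod τ M where
  toFun q := ({ toFun := fun x => φ x q
                map_add' := fun x y => by rw [map_add]; rfl
                map_smul' := fun r x => by
                  rw [LinearMap.map_smul_of_tower]; rfl } : Module.Dual k M)
  map_add' p q := DualMod.ext (τ := τ) (M := M) fun x => map_add (φ x) p q
  map_smul' f q := DualMod.ext (τ := τ) (M := M) fun x => by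
    change φ x (f • q) = φ (τ.pull f • x) q
    rw [φ.map_smul, DualMod.smul_apply, h]

/-- The dual of a finite-dimensional projective comodule is injective, since a map into it is
extended by lifting its transpose. Being finite-dimensional, it is then a direct summand of some
`C^n`. -/
theorem HasCodualBasis.dualMod (τ : CoalgFlip k D C) (Q : Comod k D) [Projective Q]
    [FiniteDimensional k Q] : HasCodualBasis k C (DualMod τ Q) := by
  refine HasCodualBasis.of_extends ((isRational_comodule k D Q).dualMod τ) ?_
  intro Y _ _ _ _ hY _ X φ
  have hX : IsRational k C X := hY.of_injective X.subtype X.subtype_injective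
  have hfd : FiniteDimensional k X := FiniteDimensional.finiteDimensional_submodule
    (X.restrictScalars k)
  have := small_dualMod τ.symm (M := X)
  have := small_dualMod τ.symm (M := Y)
  let r : DualMod τ.symm Y →ₗ[DualAlg k D] DualMod τ.symm X :=
    { toFun := fun g => (show Module.Dual k Y from g) ∘ₗ (X.subtype.restrictScalars k)
      map_add' := fun _ _ => rfl
      map_smul' := fun _ _ => rfl }
  have hr : Function.Surjective r := fun g =>
    LinearMap.exists_extend (p := X.restrictScalars k) (show Module.Dual k X from g)
  obtain ⟨ψ, hψ⟩ := exists_lift_of_projective (hX.dualMod τ.symm) (hY.dualMod τ.symm) r hr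
    (DualMod.transpose τ.symm τ τ.pull_pull_symm φ)
  exact ⟨DualMod.transpose τ τ.symm τ.pull_symm_pull ψ, fun x => DualMod.ext fun q =>
    congrArg (fun g : DualMod τ.symm X => g x) (hψ q)⟩

/-- If the dual of `P` is a direct summand of some `D^n`, then `P` is a direct summand of a free
module over the dual algebra. -/
theorem HasDualBasis.of_dualMod (τ : CoalgFlip k C D) {P : Type*} [AddCommGroup P] [Module k P]
    [Module (DualAlg k C) P] [IsScalarTower k (DualAlg k C) P] [FiniteDimensional k P]
    (h : HasCodualBasis k D (DualMod τ P)) : HasDualBasis k C P := by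
  obtain ⟨n, ι, ρ, hρ⟩ := h
  have hp : ∀ i, ∃ p : P, ∀ g : DualMod τ P, g p = Coalgebra.counit (R := k) (ι i g) := fun i => by
    obtain ⟨p, hp⟩ := (Module.evalEquiv k P).surjective
      (Coalgebra.counit (R := k) (A := D) ∘ₗ (ι i).restrictScalars k : DualMod τ P →ₗ[k] k)
    exact ⟨p, fun g => LinearMap.congr_fun hp g⟩
  -- `p i` is the functional `ε ∘ ι i` on the dual of `P`, read in the double dual.
  choose p hp using hp
  let π : Fin n → P →ₗ[DualAlg k C] DualAlg k C := fun i =>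
    { toFun := fun x => WithConv.toConv
        ({ toFun := fun c => ρ i (τ.toEquiv c) x
           map_add' := fun c d => by rw [map_add, map_add]; rfl
           map_smul' := fun r c => by
             rw [map_smul, LinearMap.map_smul_of_tower]; rfl } : C →ₗ[k] k)
      map_add' := fun x y => WithConv.ofConv_injective (LinearMap.ext fun c =>
        map_add (ρ i (τ.toEquiv c)) x y)
      map_smul' := fun f x => WithConv.ofConv_injective (LinearMap.ext fun c => by
        change ρ i (τ.toEquiv c) (f • x) = (f * WithConv.toConv _ : DualAlg k C).ofConv c
        rw [← apply_rightAct]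
        change _ = ρ i (τ.toEquiv (rightAct f c)) x
        rw [← τ.pull_pull_symm f, ← τ.smul_toEquiv, (ρ i).map_smul, DualMod.smul_apply]) }
  have hπ : ∀ i x c, (π i x).ofConv c = ρ i (τ.toEquiv c) x := fun _ _ _ => rfl
  refine ⟨n, p, π, fun x => ?_⟩
  refine sub_eq_zero.1 ((Module.forall_dual_apply_eq_zero_iff k _).1 fun g => ?_)
  have key : ∀ i, g (π i x • p i) = ρ i (ι i g) x := fun i => by
    have h1 := hp i (τ.symm.pull (π i x) • (show DualMod τ P from g))
    rw [DualMod.smul_apply, τ.pull_pull_symm, (ι i).map_smul, counit_smul] at h1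
    refine h1.trans ((τ.symm.pull_apply _ _).trans ((hπ _ _ _).trans ?_))
    exact congrArg (fun d => ρ i d x) (τ.toEquiv.apply_symm_apply _)
  rw [map_sub, sub_eq_zero, map_sum, Finset.sum_congr rfl fun i _ => key i]
  exact (LinearMap.sum_apply _ (fun i => (show Module.Dual k P from ρ i (ι i g))) x).symm.trans
    (congrArg (fun h : DualMod τ P => h x) (hρ g))

end Duality

/-! ### Projective covers and injective envelopes -/

section Semiperfect

variable {k : Type u} [Field k] {C : Type v} [AddCommGroup C] [Module k C] [Coalgebra k C]

/-- A projective cover of a finite-dimensional comodule is finite-dimensional: some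
finite-dimensional subcomodule is mapped onto the comodule, and hence is everything. -/
theorem IsProjectiveCover.finiteDimensional {P M : Comod k C} [FiniteDimensional k M] {p : P ⟶ M}
    (hp : IsProjectiveCover p) : FiniteDimensional k P := by
  have := hp.epi
  let b := Module.finBasis k M
  choose x hx using fun i => comod_surjective_of_epi p (b i)
  let F : Submodule (DualAlg k C) P := Submodule.span _ (Set.range x)
  have hF : IsRational k C F :=
    (isRational_comodule k C P).of_injective F.subtype F.subtype_injective
  have hfd : FiniteDimensional k F := (isRational_comodule k C P).finite_of_fg F
    (Submodule.fg_span (Set.finite_range x))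
  let g : hF.comod ⟶ P := homOfLin (F.subtype ∘ₗ hF.equiv.symm.toLinearMap)
  have hg : Epi (g ≫ p) := comod_epi_of_surjective _ fun m => by
    refine ⟨∑ i, b.repr m i • hF.equiv ⟨x i, Submodule.subset_span ⟨i, rfl⟩⟩, ?_⟩
    conv_rhs => rw [← b.sum_repr m]
    rw [map_sum]
    refine Finset.sum_congr rfl fun i _ => ?_
    rw [map_smul]
    exact congrArg _ (hx i)
  have := hp.essential _ g hg
  exact Module.Finite.of_surjective (F.subtype.restrictScalars k) (comod_surjective_of_epi g)

/-- Over a right semiperfect coalgebra, finite-dimensional comodules are quotients of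
finite-dimensional projective comodules. -/
theorem IsRightSemiperfect.exists_projective (hC : IsRightSemiperfect k C) (M : Comod k C)
    [FiniteDimensional k M] : ∃ P : Comod k C, Projective P ∧ FiniteDimensional k P ∧
      ∃ p : P →ₗ[DualAlg k C] M, Function.Surjective p := by
  obtain ⟨P, p, hp⟩ := hC M inferInstance
  have := hp.epi
  exact ⟨P, hp.projective, hp.finiteDimensional, linOfHom p, comod_surjective_of_epi p⟩

/-- Over a right semiperfect coalgebra, finite-dimensional rational modules are quotients of
finite-dimensional comodules that are projective over the dual algebra. -/
theorem IsRightSemiperfect.exists_dualBasis (hC : IsRightSemiperfect k C) {M : Type v}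
    [AddCommGroup M] [Module k M] [Module (DualAlg k C) M] [IsScalarTower k (DualAlg k C) M]
    [FiniteDimensional k M] (hM : IsRational k C M) :
    ∃ P : Comod k C, FiniteDimensional k P ∧ HasDualBasis k C P ∧
      ∃ p : P →ₗ[DualAlg k C] M, Function.Surjective p := by
  have : FiniteDimensional k hM.comod := inferInstanceAs (FiniteDimensional k M)
  obtain ⟨P, _, hfd, p, hp⟩ := hC.exists_projective hM.comod
  refine ⟨P, hfd, HasDualBasis.of_dualMod (copFlip k C)
    (HasCodualBasis.dualMod (copFlip k C) P),
    hM.equiv.symm.toLinearMap ∘ₗ p, hM.equiv.symm.surjective.comp hp⟩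

/-- Over a left semiperfect coalgebra, finite-dimensional rational modules embed into
finite-dimensional direct summands of some `C^n`, by duality. -/
theorem IsLeftSemiperfect.exists_codualBasis (hC : IsLeftSemiperfect k C) {M : Type v}
    [AddCommGroup M] [Module k M] [Module (DualAlg k C) M] [IsScalarTower k (DualAlg k C) M]
    [FiniteDimensional k M] (hM : IsRational k C M) :
    ∃ E : Comod k C, FiniteDimensional k E ∧ HasCodualBasis k C E ∧
      ∃ j : M →ₗ[DualAlg k C] E, Function.Injective j := by
  let τ := copFlip k C
  have hMd := hM.dualMod τ
  have := small_dualMod τ (M := M)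
  obtain ⟨Q, _, hQ, q, hq⟩ := IsRightSemiperfect.exists_projective hC hMd.shrinkComod
  have hE := HasCodualBasis.dualMod τ.symm Q
  have hErat := (isRational_comodule k (Cop C) Q).dualMod τ.symm
  have := small_dualMod τ.symm (M := Q)
  let q' : Q →ₗ[DualAlg k (Cop C)] DualMod τ M := hMd.shrinkEquiv.symm.toLinearMap ∘ₗ q
  have hq' : Function.Surjective q' := hMd.shrinkEquiv.symm.surjective.comp hq
  -- Transposing a surjection `Q → M^*` embeds `M` into `Q^*`.
  let j : M →ₗ[DualAlg k C] DualMod τ.symm Q :=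
    DualMod.transpose τ.symm τ τ.pull_pull_symm q'
  have hj : Function.Injective j := (injective_iff_map_eq_zero j).2 fun m hm => by
    refine (Module.forall_dual_apply_eq_zero_iff k m).1 fun g => ?_
    obtain ⟨x, hx⟩ := hq' g
    exact (congrArg (fun g : DualMod τ M => g m) hx).symm.trans
      (congrArg (fun g : DualMod τ.symm Q => g x) hm)
  exact ⟨hErat.shrinkComod, inferInstance,
    hE.retract hErat.shrinkEquiv.symm.toLinearMap hErat.shrinkEquiv.toLinearMap
      hErat.shrinkEquiv.apply_symm_apply,
    hErat.shrinkEquiv.toLinearMap ∘ₗ j, hErat.shrinkEquiv.injective.comp hj⟩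

end Semiperfect

/-! ### The comodule `C ⊗_{C^*} P` -/

section Tensor

variable {k : Type u} [Field k] {C : Type v} [AddCommGroup C] [Module k C] [Coalgebra k C]

theorem isRational_dualTensor (M : Type*) [AddCommGroup M] [Module k M] [RightComodule k C M] :
    IsRational k C (DualTensor k C M) := isRational_comodule k C _

variable {P : Type*} [AddCommGroup P] [Module k P] [RightComodule k C P]

variable (k C) in
/-- The colinear map `c ↦ c ⊗ p`. -/
def tmulRight (p : P) : C →ₗ[DualAlg k C] DualTensor k C P where
  toFun c := dualTmul k C c p
  map_add' c d := by rw [dualTmul, add_tmul, map_add]; rfl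
  map_smul' f c := (leftAct_dualTmul k C f c p).symm

theorem dualTmul_add_right (p q : P) (c : C) :
    dualTmul k C c (p + q) = dualTmul k C c p + dualTmul k C c q := by
  rw [dualTmul, tmul_add, map_add]; rfl

theorem dualTmul_smul_right (r : k) (p : P) (c : C) :
    dualTmul k C c (r • p) = r • dualTmul k C c p := by
  rw [dualTmul, tmul_smul, map_smul]; rfl

/-- The colinear map `c ⊗ p ↦ c ↼ π(p)`, for a linear form `π` over the dual algebra. -/
def tensorEval (π : P →ₗ[DualAlg k C] DualAlg k C) : DualTensor k C P →ₗ[DualAlg k C] C :=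
  let e : DualTensor k C P →ₗ[k] C := (balanced k C P).liftQ
    (TensorProduct.lift (LinearMap.mk₂ k (fun c p => rightAct (π p) c)
      (fun _ _ _ => map_add _ _ _) (fun _ _ _ => map_smul _ _ _)
      (fun c p q => by rw [map_add, rightAct_add])
      (fun r c p => by rw [π.map_smul_of_tower, rightAct_smul])))
    (by
      refine Submodule.span_le.2 ?_
      rintro _ ⟨f, c, p, rfl⟩
      rw [SetLike.mem_coe, LinearMap.mem_ker, map_sub, sub_eq_zero, lift.tmul, lift.tmul,
        LinearMap.mk₂_apply, LinearMap.mk₂_apply, ← rightAct_mul, ← smul_eq_leftAct, map_smul,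
        smul_eq_mul])
  { toFun := e
    map_add' := map_add e
    map_smul' := fun f x => LinearMap.congr_fun (f := e ∘ₗ leftAct f) (g := leftAct f ∘ₗ e)
      (dualTensor_ext k C fun c p => by
        rw [LinearMap.comp_apply, leftAct_dualTmul]
        exact (leftAct_rightAct (π p) f c).symm) x }

theorem tensorEval_tmul (π : P →ₗ[DualAlg k C] DualAlg k C) (c : C) (p : P) :
    tensorEval π (dualTmul k C c p) = rightAct (π p) c := rfl

/-- A dual basis of `P` induces a codual basis of `C ⊗_{C^*} P`. -/
theorem sum_tmul_tensorEval {n : ℕ} {p : Fin n → P} {π : Fin n → P →ₗ[DualAlg k C] DualAlg k C}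
    (h : ∀ x, ∑ i, π i x • p i = x) (z : DualTensor k C P) :
    ∑ i, tmulRight k C (p i) (tensorEval (π i) z) = z := by
  have key : (∑ i, tmulRight k C (p i) ∘ₗ tensorEval (π i)).restrictScalars k =
      LinearMap.id := dualTensor_ext k C fun c q => by
    simp only [LinearMap.restrictScalars_apply, LinearMap.sum_apply, LinearMap.comp_apply,
      tensorEval_tmul, LinearMap.id_apply]
    conv_rhs => rw [← h q]
    have h1 : ∀ i, tmulRight k C (p i) (rightAct (π i q) c) = dualTmul k C c (π i q • p i) :=
      fun i => dualTmul_balanced k C (π i q) c (p i)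
    simp only [h1]
    exact (map_sum (AddMonoidHom.mk' (fun x : P => dualTmul k C c x)
      fun x y => dualTmul_add_right x y c) _ _).symm
  have h2 := LinearMap.congr_fun key z
  simpa using h2

/-- If `P` is a direct summand of `A^n`, then `C ⊗_{C^*} P` is a direct summand of `C^n`. -/
theorem HasDualBasis.hasCodualBasis_dualTensor (h : HasDualBasis k C P) :
    HasCodualBasis k C (DualTensor k C P) := by
  obtain ⟨n, p, π, hp⟩ := h
  exact ⟨n, fun i => tensorEval (π i), fun i => tmulRight k C (p i), sum_tmul_tensorEval hp⟩

/-- `C ⊗_{C^*} P` is finite-dimensional for a finite-dimensional projective `P`. The sum `X` of the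
images of all maps from `P` is finite-dimensional, and it is essential, because every nonzero
subcomodule is hit by a nonzero map from `P`. Hence an embedding of `X` into a finite-dimensional
injective comodule extends to an embedding of `C ⊗_{C^*} P`. -/
theorem HasDualBasis.finite_dualTensor {P : Type v} [AddCommGroup P] [Module k P]
    [RightComodule k C P] [FiniteDimensional k P] (hC : IsLeftSemiperfect k C)
    (h : HasDualBasis k C P) : FiniteDimensional k (DualTensor k C P) := by
  obtain ⟨n, p, π, hp⟩ := h
  have hfin : FiniteDimensional k (P →ₗ[DualAlg k C] C) := finite_toCofree
  have hhom : FiniteDimensional k (P →ₗ[DualAlg k C] DualTensor k C P) :=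
    Module.Finite.of_injective
      ({ toFun := fun θ i => tensorEval (π i) ∘ₗ θ
         map_add' := fun θ θ' => by ext; simp
         map_smul' := fun r θ => by
          funext i
          ext x
          exact LinearMap.map_smul_of_tower (tensorEval (π i)) r (θ x) } :
        (P →ₗ[DualAlg k C] DualTensor k C P) →ₗ[k] (Fin n → P →ₗ[DualAlg k C] C))
      fun θ θ' hθ => LinearMap.ext fun x => by
        rw [← sum_tmul_tensorEval hp (θ x), ← sum_tmul_tensorEval hp (θ' x)]
        refine Finset.sum_congr rfl fun i _ => congrArg _ ?_
        exact LinearMap.congr_fun (congrFun hθ i) x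
  -- `X` is the sum of the images of a basis of the space of maps `P → C ⊗_{C^*} P`.
  let b := Module.finBasis k (P →ₗ[DualAlg k C] DualTensor k C P)
  let Θ : (Fin _ → P) →ₗ[DualAlg k C] DualTensor k C P :=
    ∑ a, b a ∘ₗ LinearMap.proj a
  let X := LinearMap.range Θ
  have hXfd : FiniteDimensional k X :=
    Module.Finite.of_surjective (Θ.rangeRestrict.restrictScalars k) Θ.surjective_rangeRestrict
  have hX : ∀ (θ : P →ₗ[DualAlg k C] DualTensor k C P) (x : P), θ x ∈ X := fun θ x => by
    have hb : ∀ a, b a x ∈ X := fun a => ⟨Pi.single a x, by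
      classical
      rw [LinearMap.sum_apply, Finset.sum_eq_single a]
      · simp
      · intro c _ hc
        simp [Pi.single_eq_of_ne hc]
      · simp⟩
    rw [← b.sum_repr θ, LinearMap.sum_apply]
    exact Submodule.sum_mem _ fun a _ => by
      rw [LinearMap.smul_apply]
      exact X.smul_of_tower_mem _ (hb a)
  have hI := isRational_dualTensor (k := k) (C := C) P
  have hXrat : IsRational k C X := hI.of_injective X.subtype X.subtype_injective
  obtain ⟨E, hE, hcod, j, hj⟩ := hC.exists_codualBasis hXrat
  obtain ⟨J, hJ⟩ := hcod.exists_extend (X := X) hI X.subtype X.subtype_injective j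
  refine Module.Finite.of_injective (J.restrictScalars k)
    ((injective_iff_map_eq_zero J).2 fun z hz => ?_)
  -- The maps `x ↦ π i x • g • z` from `P` take values in `X`, where `J` is injective, and are
  -- killed by `J`; these maps detect whether `z` vanishes.
  have hzero : ∀ (i : Fin n) (x : P) (g : DualAlg k C), π i x • g • z = 0 := fun i x g => by
    let θ : P →ₗ[DualAlg k C] DualTensor k C P :=
      LinearMap.toSpanSingleton (DualAlg k C) _ (g • z) ∘ₗ π i
    have h1 : j ⟨θ x, hX θ x⟩ = 0 := by
      rw [← hJ]
      change J (π i x • g • z) = 0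
      rw [map_smul, map_smul, hz, smul_zero, smul_zero]
    exact congrArg Subtype.val (hj (h1.trans (LinearMap.map_zero j).symm))
  rw [← sum_tmul_tensorEval hp z]
  refine Finset.sum_eq_zero fun i _ => ?_
  have hi : tensorEval (π i) z = 0 := dual_ext (k := k) fun g => by
    rw [map_zero]
    conv_lhs => rw [← sum_tmul_tensorEval hp z]
    rw [map_sum, map_sum]
    refine Finset.sum_eq_zero fun l _ => ?_
    change g.ofConv (rightAct (π i (p l)) (tensorEval (π l) z)) = 0
    rw [apply_rightAct, ← counit_smul, ← map_smul, mul_smul, hzero, map_zero, map_zero]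
  rw [hi, map_zero]

end Tensor

/-! ### The module `Hom^C(C, E)` -/

section Hom

variable {k : Type u} [Field k] {C : Type v} [AddCommGroup C] [Module k C] [Coalgebra k C]
variable {E : Type*} [AddCommGroup E] [Module k E] [RightComodule k C E]

/-- The elements of `Hom^C(C, E)` as linear maps over the dual algebra. -/
def comodHomEquiv : comodHom k C C E ≃ₗ[k] (C →ₗ[DualAlg k C] E) where
  toFun φ := { toFun := φ.1
               map_add' := map_add φ.1
               map_smul' := (mem_comodHom_iff φ.1).1 φ.2 }
  invFun φ := ⟨φ.restrictScalars k, (mem_comodHom_iff _).2 (map_smul φ)⟩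
  map_add' _ _ := rfl
  map_smul' _ _ := rfl
  left_inv _ := rfl
  right_inv _ := rfl

/-- Every colinear endomorphism of `C` is the right action of a functional. -/
theorem rightAct_counit_comp (ψ : C →ₗ[DualAlg k C] C) (c : C) :
    rightAct (WithConv.toConv (Coalgebra.counit (R := k) (A := C) ∘ₗ ψ.restrictScalars k)) c =
      ψ c := by
  refine dual_ext (k := k) fun g => ?_
  rw [apply_rightAct, ← apply_leftAct, apply_toCofree]
  rfl

/-- The linear map `φ ↦ ε ∘ ι ∘ φ` from `Hom^C(C, E)` to the dual algebra. -/
def homCoord (ι : E →ₗ[DualAlg k C] C) : comodHom k C C E →ₗ[DualAlg k C] DualAlg k C where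
  toFun φ := WithConv.toConv (Coalgebra.counit (R := k) (A := C) ∘ₗ ι.restrictScalars k ∘ₗ φ.1)
  map_add' φ ψ := WithConv.ofConv_injective (LinearMap.ext fun c => by
    change Coalgebra.counit (R := k) (ι (φ.1 c + ψ.1 c)) = _
    rw [map_add, map_add]
    rfl)
  map_smul' f φ := WithConv.ofConv_injective (LinearMap.ext fun c =>
    apply_rightAct (WithConv.toConv
      (Coalgebra.counit (R := k) (A := C) ∘ₗ ι.restrictScalars k ∘ₗ φ.1)) f c)

theorem rightAct_homCoord (ι : E →ₗ[DualAlg k C] C) (φ : comodHom k C C E) (c : C) :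
    rightAct (homCoord ι φ) c = ι (φ.1 c) :=
  rightAct_counit_comp (ι ∘ₗ comodHomEquiv φ) c

/-- Let `ι`, `ρ` be a codual basis of `E`. The coordinates `homCoord (ι i)` together with the `ρ i`
form a dual basis of `Hom^C(C, E)`, and here each `ρ i` may be replaced by any map `y i` that agrees
with it on the image of `ι i`. -/
theorem sum_homCoord_smul {n : ℕ} {ι : Fin n → E →ₗ[DualAlg k C] C}
    {ρ : Fin n → C →ₗ[DualAlg k C] E} (h : ∀ x, ∑ i, ρ i (ι i x) = x)
    (y : Fin n → comodHom k C C E) (hy : ∀ i e, (y i).1 (ι i e) = ρ i (ι i e))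
    (φ : comodHom k C C E) : ∑ i, homCoord (ι i) φ • y i = φ := by
  refine Subtype.ext (LinearMap.ext fun c => ?_)
  rw [AddSubmonoidClass.coe_finsetSum, LinearMap.sum_apply]
  simp only [homSMul_apply, rightAct_homCoord, hy, h]

/-- If `E` is a direct summand of `C^n`, then `Hom^C(C, E)` is a direct summand of `A^n`. -/
theorem HasCodualBasis.hasDualBasis_comodHom (h : HasCodualBasis k C E) :
    HasDualBasis k C (comodHom k C C E) := by
  obtain ⟨n, ι, ρ, hρ⟩ := h
  exact ⟨n, fun i => comodHomEquiv.symm (ρ i), fun i => homCoord (ι i),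
    sum_homCoord_smul hρ _ fun _ _ => rfl⟩

variable (k C E) in
/-- The submodule of the maps `φ : C → E` such that `φ ∘ ι = 0` for all colinear `ι : E → C`. -/
def reject : Submodule (DualAlg k C) (comodHom k C C E) where
  carrier := {φ | ∀ (ι : E →ₗ[DualAlg k C] C) (e : E), φ.1 (ι e) = 0}
  add_mem' {φ ψ} hφ hψ ι e := by
    change φ.1 (ι e) + ψ.1 (ι e) = 0
    rw [hφ, hψ, add_zero]
  zero_mem' _ _ := rfl
  smul_mem' f φ hφ ι e :=
    hφ { toFun := fun e => rightAct f (ι e)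
         map_add' := fun x y => by rw [map_add, map_add]
         map_smul' := fun g x => by
          rw [map_smul, RingHom.id_apply, smul_eq_leftAct, smul_eq_leftAct, leftAct_rightAct] } e

theorem finite_quotient_reject [FiniteDimensional k E] :
    FiniteDimensional k (comodHom k C C E ⧸ reject k C E) := by
  have hfin : FiniteDimensional k (E →ₗ[DualAlg k C] C) := finite_toCofree
  -- `reject k C E` is the kernel of `φ ↦ (ι ↦ φ ∘ ι)`, whose target is finite-dimensional.
  let Ψ : comodHom k C C E →ₗ[k] ((E →ₗ[DualAlg k C] C) →ₗ[k] (E →ₗ[k] E)) :=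
    LinearMap.mk₂ k (fun φ ι => φ.1 ∘ₗ ι.restrictScalars k) (fun _ _ _ => rfl) (fun _ _ _ => rfl)
      (fun φ ι ι' => by ext; simp) (fun r φ ι => by ext; simp)
  have hΨ : LinearMap.ker Ψ = (reject k C E).restrictScalars k := by
    ext φ
    refine ⟨fun h ι e => LinearMap.congr_fun (LinearMap.congr_fun h ι) e, fun h => ?_⟩
    exact LinearMap.ext fun ι => LinearMap.ext fun e => h ι e
  have h1 : FiniteDimensional k
      (comodHom k C C E ⧸ (reject k C E).restrictScalars k) := by
    rw [← hΨ]
    exact Module.Finite.of_injective _ (LinearMap.ker_eq_bot.1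
      (Ψ.ker.ker_liftQ_eq_bot Ψ le_rfl le_rfl))
  exact Module.Finite.of_surjective
    (Submodule.Quotient.restrictScalarsEquiv k (reject k C E)).toLinearMap
    (Submodule.Quotient.restrictScalarsEquiv k (reject k C E)).surjective

theorem isRational_quotient_reject [FiniteDimensional k E] :
    IsRational k C (comodHom k C C E ⧸ reject k C E) := by
  obtain ⟨V, hV, hf⟩ := (isRational_comodule k C E).exists_uniform
  intro x
  obtain ⟨φ, rfl⟩ := (reject k C E).mkQ_surjective x
  refine ⟨V, hV, fun f h0 => ?_⟩
  rw [← map_smul]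
  refine (Submodule.Quotient.mk_eq_zero _).2 fun ι e => ?_
  have h1 : rightAct f (ι e) = 0 := dual_ext (k := k) fun g => by
    rw [apply_rightAct, map_zero, ← counit_smul, ← map_smul, mul_smul, hf f h0, map_zero, map_zero]
  rw [homSMul_apply, h1, map_zero]

/-- `Hom^C(C, E)` is a finite-dimensional rational module for a finite-dimensional direct summand
`E` of `C^n`. Its quotient by `reject k C E` is finite-dimensional and rational, hence is covered by
some finite-dimensional projective `P`; the lift `P → Hom^C(C, E)` is surjective since
`reject k C E` is superfluous by `sum_homCoord_smul`. -/
theorem HasCodualBasis.finite_comodHom {E : Type v} [AddCommGroup E] [Module k E]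
    [RightComodule k C E] [FiniteDimensional k E] (hC : IsRightSemiperfect k C)
    (h : HasCodualBasis k C E) : FiniteDimensional k (comodHom k C C E) ∧
      IsRational k C (comodHom k C C E) := by
  obtain ⟨n, ι, ρ, hρ⟩ := h
  have := finite_quotient_reject (k := k) (C := C) (E := E)
  obtain ⟨P, hP, hdual, p, hp⟩ := hC.exists_dualBasis
    (isRational_quotient_reject (k := k) (C := C) (E := E))
  obtain ⟨g, hg⟩ := hdual.exists_lift (reject k C E).mkQ (reject k C E).mkQ_surjective p
  have hsurj : Function.Surjective g := by
    -- `g (x i)` agrees with `ρ i` modulo `reject k C E`, in particular on the image of `ι i`.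
    choose x hx using fun i => hp ((reject k C E).mkQ (comodHomEquiv.symm (ρ i)))
    intro φ
    refine ⟨∑ i, homCoord (ι i) φ • x i, ?_⟩
    rw [map_sum]
    simp only [map_smul]
    refine sum_homCoord_smul hρ (fun i => g (x i)) (fun i e => ?_) φ
    have h1 := (Submodule.Quotient.eq (reject k C E)).1 ((hg (x i)).trans (hx i)) (ι i) e
    exact sub_eq_zero.1 h1
  exact ⟨Module.Finite.of_surjective (g.restrictScalars k) hsurj,
    (isRational_comodule k C P).of_surjective g hsurj⟩

end Hom

/-! ### The adjunction -/

section Adjunction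

variable (k : Type u) [Field k] (C : Type v) [AddCommGroup C] [Module k C] [Coalgebra k C]

/-- The colinear map `c ↦ c ⊗ m` as an element of `Hom^C(C, C ⊗_{C^*} M)`, linearly in `m`. -/
def unitLin (M : Comod k C) : M →ₗ[k] comodHom k C C ((nakR k C).obj M) where
  toFun m := comodHomEquiv.symm (tmulRight k C m)
  map_add' m m' := Subtype.ext (LinearMap.ext fun c => dualTmul_add_right m m' c)
  map_smul' r m := Subtype.ext (LinearMap.ext fun c => dualTmul_smul_right r m c)

theorem unitLin_smul (M : Comod k C) (f : DualAlg k C) (m : M) :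
    unitLin k C M (leftAct f m) = f • unitLin k C M m :=
  Subtype.ext (LinearMap.ext fun c => (dualTmul_balanced k C f c m).symm)

/-- The unit `m ↦ (c ↦ c ⊗ m)`. -/
def nakUnit (M : Comod k C) : M ⟶ (nakL k C).obj ((nakR k C).obj M) :=
  let g := (unitLin k C M).codRestrict (rat k C _)
    (map_mem_rat k C (unitLin k C M) (unitLin_smul k C M))
  ⟨g, (mem_comodHom_iff _).2 fun f m => Subtype.ext
    ((unitLin_smul k C M f m).trans (leftAct_rat k C f (g m)).symm)⟩

theorem nakUnit_apply (M : Comod k C) (m : M) (c : C) :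
    (((nakUnit k C M).1 m).1).1 c = dualTmul k C c m := rfl

/-- The linear map `c ⊗ ξ ↦ ξ(c)`. -/
def counitLin (M : Comod k C) : DualTensor k C ((nakL k C).obj M) →ₗ[k] M :=
  (balanced k C ((nakL k C).obj M)).liftQ
    (TensorProduct.lift (LinearMap.mk₂ k (fun c (ξ : rat k C (comodHom k C C M)) => ξ.1.1 c)
      (fun ξ _ _ => map_add _ _ _) (fun _ _ _ => map_smul _ _ _)
      (fun _ _ _ => rfl) (fun _ _ _ => rfl)))
    (by
      refine Submodule.span_le.2 ?_
      rintro _ ⟨f, c, ξ, rfl⟩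
      rw [SetLike.mem_coe, LinearMap.mem_ker, map_sub, sub_eq_zero, lift.tmul, lift.tmul]
      exact (congrArg (fun φ : comodHom k C C M => φ.1 c) (leftAct_rat k C f ξ)).symm)

theorem counitLin_tmul (M : Comod k C) (c : C) (ξ : (nakL k C).obj M) :
    counitLin k C M (dualTmul k C c ξ) = (ξ.1).1 c := rfl

/-- The counit `c ⊗ ξ ↦ ξ(c)`. -/
def nakCounit (M : Comod k C) : (nakR k C).obj ((nakL k C).obj M) ⟶ M :=
  ⟨counitLin k C M, (mem_comodHom_iff _).2 fun f x =>
    LinearMap.congr_fun (f := counitLin k C M ∘ₗ leftAct f) (g := leftAct f ∘ₗ counitLin k C M)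
      (dualTensor_ext k C fun c ξ => by
        rw [LinearMap.comp_apply, LinearMap.comp_apply, leftAct_dualTmul, counitLin_tmul,
          counitLin_tmul]
        exact (mem_comodHom_iff _).1 ξ.1.2 f c) x⟩

theorem nakR_hom_ext {M X : Comod k C} {φ ψ : (nakR k C).obj M ⟶ X}
    (h : ∀ c m, φ.1 (dualTmul k C c m) = ψ.1 (dualTmul k C c m)) : φ = ψ :=
  Subtype.ext (dualTensor_ext k C h)

theorem nakL_hom_ext {M X : Comod k C} {φ ψ : X ⟶ (nakL k C).obj M}
    (h : ∀ x c, ((φ.1 x).1).1 c = ((ψ.1 x).1).1 c) : φ = ψ :=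
  comod_hom_ext fun x => Subtype.ext (Subtype.ext (LinearMap.ext (h x)))

theorem nakAdj_left_triangle (M : Comod k C) :
    (nakR k C).map (nakUnit k C M) ≫ nakCounit k C ((nakR k C).obj M) = 𝟙 _ :=
  nakR_hom_ext k C fun _ _ => rfl

theorem nakAdj_right_triangle (M : Comod k C) :
    nakUnit k C ((nakL k C).obj M) ≫ (nakL k C).map (nakCounit k C M) = 𝟙 _ :=
  nakL_hom_ext k C fun _ _ => rfl

/-- The adjunction between the two Nakayama functors, which holds for every coalgebra. -/
def nakAdj : nakR k C ⊣ nakL k C :=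
  Adjunction.mkOfUnitCounit
    { unit := { app := nakUnit k C, naturality := fun _ _ _ => nakL_hom_ext k C fun _ _ => rfl }
      counit :=
        { app := nakCounit k C, naturality := fun _ _ _ => nakR_hom_ext k C fun _ _ => rfl }
      left_triangle := by
        ext M
        simpa using nakAdj_left_triangle k C M
      right_triangle := by
        ext M
        simpa using nakAdj_right_triangle k C M }

/-- The restriction of the adjunction to finite-dimensional comodules. -/
def nakAdjFd (hR : ∀ M : FdComod k C, isFd k C ((nakR k C).obj M.obj))
    (hL : ∀ M : FdComod k C, isFd k C ((nakL k C).obj M.obj)) : nakRFd k C hR ⊣ nakLFd k C hL :=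
  Adjunction.mkOfUnitCounit
    { unit :=
        { app := fun M => ObjectProperty.homMk (nakUnit k C M.obj)
          naturality := fun _ _ _ => ObjectProperty.hom_ext _ (nakL_hom_ext k C fun _ _ => rfl) }
      counit :=
        { app := fun M => ObjectProperty.homMk (nakCounit k C M.obj)
          naturality := fun _ _ _ => ObjectProperty.hom_ext _ (nakR_hom_ext k C fun _ _ => rfl) }
      left_triangle := by
        ext M : 2
        refine ObjectProperty.hom_ext _ ?_
        simpa using nakAdj_left_triangle k C M.obj
      right_triangle := by
        ext M : 2
        refine ObjectProperty.hom_ext _ ?_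
        simpa using nakAdj_right_triangle k C M.obj }

end Adjunction

/-! ### Unit and counit on projective and injective comodules -/

section UnitCounit

variable {k : Type u} [Field k] {C : Type v} [AddCommGroup C] [Module k C] [Coalgebra k C]

/-- The inclusion of the rational part of `Hom^C(C, E)`. -/
def nakLIncl (E : Comod k C) : (nakL k C).obj E →ₗ[DualAlg k C] comodHom k C C E where
  toFun ξ := ξ.1
  map_add' _ _ := rfl
  map_smul' f ξ := leftAct_rat k C f ξ

/-- `Hom^C(C, E)` is its own rational part for a finite-dimensional direct summand `E` of `C^n`. -/
theorem HasCodualBasis.hasDualBasis_nakL {E : Comod k C} [FiniteDimensional k E]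
    (hC : IsRightSemiperfect k C) (h : HasCodualBasis k C E) :
    HasDualBasis k C ((nakL k C).obj E) := by
  have hrat := isRational_iff_mem_rat.1 (h.finite_comodHom hC).2
  let e := LinearEquiv.ofBijective (nakLIncl E)
    ⟨Subtype.val_injective, fun φ => ⟨⟨φ, hrat φ⟩, rfl⟩⟩
  exact h.hasDualBasis_comodHom.retract e.toLinearMap e.symm.toLinearMap e.symm_apply_apply

/-- The unit is an isomorphism at a direct summand of `A^n`. -/
theorem HasDualBasis.isIso_unit {P : Comod k C} (h : HasDualBasis k C P) :
    IsIso (nakUnit k C P) := by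
  obtain ⟨n, p, π, hp⟩ := h
  refine comod_isIso_of_bijective _ ⟨(injective_iff_map_eq_zero _).2 fun m hm => ?_, fun ξ => ?_⟩
  · have h1 : ∀ c, dualTmul k C c m = 0 := fun c =>
      congrArg (fun ξ : (nakL k C).obj ((nakR k C).obj P) => ξ.1.1 c) hm
    have h2 : ∀ i, π i m = 0 := fun i => WithConv.ofConv_injective (LinearMap.ext fun c => by
      rw [← counit_rightAct, ← tensorEval_tmul, h1, map_zero, map_zero]
      rfl)
    rw [← hp m]
    exact Finset.sum_eq_zero fun i _ => 
      (congrArg (· • p i) (h2 i)).trans (zero_smul (DualAlg k C) (p i))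
  · refine ⟨∑ i, homCoord (tensorEval (π i)) ξ.1 • p i,
      Subtype.ext (Subtype.ext (LinearMap.ext fun c => ?_))⟩
    rw [nakUnit_apply]
    refine Eq.trans ?_ (sum_tmul_tensorEval hp (ξ.1.1 c))
    refine (map_sum (AddMonoidHom.mk' (fun x : P => dualTmul k C c x)
      fun x y => dualTmul_add_right x y c) _ _).trans (Finset.sum_congr rfl fun i _ => ?_)
    exact (dualTmul_balanced k C _ c (p i)).symm.trans
      (congrArg (tmulRight k C (p i)) (rightAct_homCoord (tensorEval (π i)) ξ.1 c))

/-- The counit is an isomorphism at a finite-dimensional direct summand of `C^n`. -/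
theorem HasCodualBasis.isIso_counit {E : Comod k C} [FiniteDimensional k E]
    (hC : IsRightSemiperfect k C) (h : HasCodualBasis k C E) : IsIso (nakCounit k C E) := by
  have hrat := isRational_iff_mem_rat.1 (h.finite_comodHom hC).2
  obtain ⟨n, ι, ρ, hρ⟩ := h
  let y : Fin n → (nakL k C).obj E := fun i => ⟨comodHomEquiv.symm (ρ i), hrat _⟩
  let π : Fin n → (nakL k C).obj E →ₗ[DualAlg k C] DualAlg k C :=
    fun i => homCoord (ι i) ∘ₗ nakLIncl E
  have hy : ∀ ξ, ∑ i, π i ξ • y i = ξ := fun ξ => Subtype.val_injective (by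
    have h1 := map_sum (nakLIncl E) (fun i => π i ξ • y i) Finset.univ
    simp only [map_smul] at h1
    exact h1.trans (sum_homCoord_smul hρ _ (fun _ _ => rfl) ξ.1))
  -- The codual basis of `C ⊗ Hom^C(C, E)` induced by the dual basis of `Hom^C(C, E)` factors
  -- through the counit, which is therefore injective.
  have hev : ∀ i z, tensorEval (π i) z = ι i ((nakCounit k C E).1 z) := fun i z =>
    LinearMap.congr_fun (f := (tensorEval (π i)).restrictScalars k)
      (g := (ι i).restrictScalars k ∘ₗ (nakCounit k C E).1)
      (dualTensor_ext k C fun c ξ => rightAct_homCoord (ι i) ξ.1 c) z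
  refine comod_isIso_of_bijective _ ⟨(injective_iff_map_eq_zero _).2 fun z hz => ?_, fun e => ?_⟩
  · rw [← sum_tmul_tensorEval hy z]
    refine Finset.sum_eq_zero fun i _ => ?_
    exact (congrArg (tmulRight k C (y i)) ((hev i z).trans
      ((congrArg (ι i) hz).trans (map_zero (ι i))))).trans (map_zero (tmulRight k C (y i)))
  · refine ⟨∑ i, dualTmul k C (ι i e) (y i), ?_⟩
    exact (map_sum (nakCounit k C E).1 (fun i => dualTmul k C (ι i e) (y i)) _).trans (hρ e)

end UnitCounit

/-! ### Finite-dimensional comodules over semiperfect coalgebras -/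

section Semiperfect

variable {k : Type u} [Field k] {C : Type v} [AddCommGroup C] [Module k C] [Coalgebra k C]

theorem IsSemiperfect.isFd_nakR (hC : IsSemiperfect k C) (M : FdComod k C) :
    isFd k C ((nakR k C).obj M.obj) := by
  have : FiniteDimensional k M.obj := M.property
  obtain ⟨P, hP, hdual, p, hp⟩ := hC.2.exists_dualBasis (isRational_comodule k C M.obj)
  have := hdual.finite_dualTensor hC.1
  refine Module.Finite.of_surjective (dualTensorMap k C (homOfLin p)) fun z => ?_
  obtain ⟨w, rfl⟩ := (balanced k C M.obj).mkQ_surjective z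
  obtain ⟨x, rfl⟩ := LinearMap.lTensor_surjective C
    (g := (homOfLin p).1) hp w
  exact ⟨dualProj k C P x, rfl⟩

theorem IsSemiperfect.isFd_nakL (hC : IsSemiperfect k C) (M : FdComod k C) :
    isFd k C ((nakL k C).obj M.obj) := by
  have : FiniteDimensional k M.obj := M.property
  obtain ⟨E, hE, hcod, j, hj⟩ := hC.1.exists_codualBasis (isRational_comodule k C M.obj)
  have := (hcod.finite_comodHom hC.2).1
  refine Module.Finite.of_injective
    (homPost k C (homOfLin j) ∘ₗ (rat k C (comodHom k C C M.obj)).subtype) fun ξ ξ' h => ?_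
  refine Subtype.ext (Subtype.ext (LinearMap.ext fun c => hj ?_))
  exact LinearMap.congr_fun (congrArg Subtype.val h) c

/-- The projective finite-dimensional comodules are direct summands of some `A^n`. -/
theorem IsSemiperfect.hasDualBasis (hC : IsSemiperfect k C) (P : FdComod k C) [Projective P] :
    HasDualBasis k C P.obj := by
  have : FiniteDimensional k P.obj := P.property
  obtain ⟨P', hP', hdual, p, hp⟩ := hC.2.exists_dualBasis (isRational_comodule k C P.obj)
  let q : (⟨P', hP'⟩ : FdComod k C) ⟶ P := ObjectProperty.homMk (homOfLin p)
  have : Epi q := fdComod_epi_of_surjective q hp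
  have h := Projective.factorThru_comp (𝟙 P) q
  exact hdual.retract (linOfHom (Projective.factorThru (𝟙 P) q).hom) p fun x =>
    LinearMap.congr_fun (congrArg (fun f => f.hom.1) h) x

/-- The injective finite-dimensional comodules are direct summands of some `C^n`. -/
theorem IsSemiperfect.hasCodualBasis (hC : IsSemiperfect k C) (E : FdComod k C) [Injective E] :
    HasCodualBasis k C E.obj := by
  have : FiniteDimensional k E.obj := E.property
  obtain ⟨E', hE', hcod, j, hj⟩ := hC.1.exists_codualBasis (isRational_comodule k C E.obj)
  let q : E ⟶ (⟨E', hE'⟩ : FdComod k C) := ObjectProperty.homMk (homOfLin j)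
  have : Mono q := fdComod_mono_of_injective q hj
  have h := Injective.comp_factorThru (𝟙 E) q
  exact hcod.retract j (linOfHom (Injective.factorThru (𝟙 E) q).hom) fun x =>
    LinearMap.congr_fun (congrArg (fun f => f.hom.1) h) x

end Semiperfect

end Nakayama

end

theorem mainTheorem2 {k : Type u} [Field k] {C : Type v} [AddCommGroup C] [Module k C]
    [Coalgebra k C] (hC : IsSemiperfect k C) :
    -- the adjunction, identified by its unit and counit
    ∃ adj : nakR k C ⊣ nakL k C,
      (∀ (M : Comod k C) (m : M) (c : C),
        (((adj.unit.app M).1 m).1).1 c = dualTmul k C c m) ∧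
      (∀ (M : Comod k C) (c : C) (ξ : (nakL k C).obj M),
        (adj.counit.app M).1 (dualTmul k C c ξ) = (ξ.1).1 c) ∧
      -- both functors preserve finite-dimensional comodules
      ∃ (hR : ∀ M : FdComod k C, isFd k C ((nakR k C).obj M.obj))
        (hL : ∀ M : FdComod k C, isFd k C ((nakL k C).obj M.obj)),
        -- (a) the adjunction restricts
        (∃ adjFd : nakRFd k C hR ⊣ nakLFd k C hL,
          (∀ M : FdComod k C, (adjFd.unit.app M).hom = adj.unit.app M.obj) ∧
          (∀ M : FdComod k C, (adjFd.counit.app M).hom = adj.counit.app M.obj)) ∧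
        -- (b) mutually quasi-inverse functors between injectives and projectives
        ∃ (hI : ∀ E : InjFd k C, Projective ((nakLFd k C hL).obj E.obj))
          (hP : ∀ P : ProjFd k C, Injective ((nakRFd k C hR).obj P.obj)),
          Nonempty (restrictInjProj k C (nakLFd k C hL) hI ⋙
            restrictProjInj k C (nakRFd k C hR) hP ≅ 𝟭 (InjFd k C)) ∧
          Nonempty (restrictProjInj k C (nakRFd k C hR) hP ⋙
            restrictInjProj k C (nakLFd k C hL) hI ≅ 𝟭 (ProjFd k C)) := by
  have hinj (E : InjFd k C) : HasCodualBasis k C E.obj.obj :=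
    have : Injective E.obj := E.property
    hC.hasCodualBasis E.obj
  have hproj (P : ProjFd k C) : HasDualBasis k C P.obj.obj :=
    have : Projective P.obj := P.property
    hC.hasDualBasis P.obj
  refine ⟨nakAdj k C, fun _ _ _ => rfl, fun _ _ _ => rfl, hC.isFd_nakR, hC.isFd_nakL,
    ⟨nakAdjFd k C hC.isFd_nakR hC.isFd_nakL, fun _ => rfl, fun _ => rfl⟩,
    fun E => ?_, fun P => (hproj P).hasCodualBasis_dualTensor.injective, ⟨?_⟩, ⟨?_⟩⟩
  · have : FiniteDimensional k E.obj.obj := E.obj.property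
    have h : HasDualBasis k C ((nakL k C).obj E.obj.obj) := (hinj E).hasDualBasis_nakL hC.2
    exact HasDualBasis.projective h
  · refine NatIso.ofComponents (fun E => ?_) ?_
    · have : FiniteDimensional k E.obj.obj := E.obj.property
      have := (hinj E).isIso_counit hC.2
      exact ObjectProperty.isoMk _ (ObjectProperty.isoMk _ (asIso (nakCounit k C E.obj.obj)))
    · intro E E' f
      refine ObjectProperty.hom_ext _ (ObjectProperty.hom_ext _ ?_)
      exact nakR_hom_ext k C fun _ _ => rfl
  · refine (NatIso.ofComponents (fun P => ?_) ?_ : 𝟭 (ProjFd k C) ≅ _).symm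
    · have := (hproj P).isIso_unit
      exact ObjectProperty.isoMk _ (ObjectProperty.isoMk _ (asIso (nakUnit k C P.obj.obj)))
    · intro P P' f
      refine ObjectProperty.hom_ext _ (ObjectProperty.hom_ext _ ?_)
      exact nakL_hom_ext k C fun _ _ => rfl
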